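/- Let $X=(X_t)_{t\ge 0}$ be a Lévy subordinator without drift and with Lévy measure $\nu$ on $(0,\infty)$, $\int (z\wedge 1)\,\nu(dz)<\infty$, i.e. $\mathsf E e^{-uX_1}=e^{\psi(u)}$ with $\psi(u)=\int_0^\infty(e^{-uz}-1)\,\nu(dz)$ for $\Re u\ge 0$. For a real-valued Lévy process $L$ with Lévy measure $\nu_L$ (from its Lévy–Khintchine triplet) let $$\mathfrak B(L)=\inf\Big\{p>0:\int_{[-1,1]}|z|^p\,\nu_L(dz)<\infty\Big\}$$ be its Blumenthal–Getoor index. For $n>0$ let $X^{(n)}$, $Y^{(n)}$, $Z^{(n)}$ be the regulated $X$-clocks of types I, II, III of degree $n$, which are Lévy subordinators determined in law as follows. For integers $n\ge 1$ and every $t\ge0$ (all averages being $0$ at $t=0$): type I: $X^{(n)}_t\overset{d}{=}\bar X^{(n)}_t$, where $\bar X^{(0)}=X$ and $\bar X^{(n)}_t=\frac1t\int_0^t\bar X^{(n-1)}_s\,ds$; type II: $Y^{(0)}=X$ and $Y^{(n)}_t\overset{d}{=}\frac1t\int_0^tY^{(n-1)}_s\,ds$; type III: $Z^{(n)}_t\overset{d}{=}t^{-n}(I^nX)_t$,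 where $(If)_t=\int_0^tf_s\,ds$. For non-integer $n>0$ they are given by the same formulas for the Laplace transforms as hold for integer $n$: for $t\ge 0$, $\Re u\ge0$, $$\mathsf E e^{-uX^{(n)}_t}=\exp\Big(t\int_0^1\psi\Big(\Big(1-\tfrac{\Gamma(n,-\log s)}{\Gamma(n)}\Big)u\Big)ds\Big),$$ $$\mathsf E e^{-uY^{(n)}_t}=\exp\Big(\tfrac{t}{\Gamma(n)}\int_0^1(-\log v)^{n-1}\psi(uv)\,dv\Big),$$ $$\mathsf E e^{-uZ^{(n)}_t}=\exp\Big(t\int_0^1\psi\Big(\tfrac{s^nu}{\Gamma(n+1)}\Big)ds\Big),$$ with $\Gamma(n,a)=\int_a^\infty x^{n-1}e^{-x}\,dx$. For $\mu,\theta\in\mathbb R$, a clock $V$ and a standard Brownian motion $W$ independent of $V$, put $\Xi_t=\mu t+\theta V_t+W_{V_t}$, and denote this process by $\Xi^X$, $\Xi^{(n),X}$, $\Xi^{(n),Y}$, $\Xi^{(n),Z}$ for $V=X,X^{(n)},Y^{(n)},Z^{(n)}$, respectively. Then each of these mixtures has a Lévy measure, and for every $n>0$ $$\mathfrak B(\Xi^{(n),X})=\mathfrak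 B(\Xi^{(n),Y})=\mathfrak B(\Xi^{(n),Z})=\mathfrak B(\Xi^X)=2\,\mathfrak B(X).$$ -/

import Mathlib

open MeasureTheory ProbabilityTheory Set Filter Topology
open scoped NNReal ENNReal

universe u

/-- A path indexed by `[0, ∞)` is right-continuous with left limits. -/
def IsCadlag (f : ℝ≥0 → ℝ) : Prop :=
  ∀ t : ℝ≥0, ContinuousWithinAt f (Ici t) t ∧ ∃ l : ℝ, Tendsto f (𝓝[<] t) (𝓝 l)

/-- Real-valued Lévy processes on a probability space. -/
structure IsLevyProcess {Ω : Type u} [MeasurableSpace Ω] (P : Measure Ω)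
    (X : ℝ≥0 → Ω → ℝ) : Prop where
  isProbabilityMeasure : IsProbabilityMeasure P
  measurable : ∀ t, Measurable (X t)
  zero : ∀ᵐ ω ∂P, X 0 ω = 0
  indepIncrements : HasIndepIncrements X P
  stationaryIncrements : ∀ s t : ℝ≥0, IdentDistrib (fun ω => X (s + t) ω - X s ω) (X t) P P
  cadlag : ∀ᵐ ω ∂P, IsCadlag (fun t => X t ω)

/-- Lévy subordinators: Lévy processes with nondecreasing paths. -/
structure IsSubordinator {Ω : Type u} [MeasurableSpace Ω] (P : Measure Ω)
    (X : ℝ≥0 → Ω → ℝ) : Prop extends IsLevyProcess P X where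
  monotone : ∀ᵐ ω ∂P, Monotone (fun t => X t ω)

/-- The Laplace exponent `∫ (e^{-uz} - 1) ν(dz)` of a driftless subordinator with Lévy measure
`ν`; it is the continuous branch of `log φ_{X_1}(u)` that vanishes at `u = 0`. -/
noncomputable def laplaceExponent (ν : Measure ℝ) (u : ℂ) : ℂ :=
  ∫ z, (Complex.exp (-u * (z : ℂ)) - 1) ∂ν

/-- `X` is a Lévy subordinator without drift, whose Lévy measure is `ν`. -/
structure IsDriftlessSubordinator {Ω : Type u} [MeasurableSpace Ω] (P : Measure Ω)
    (X : ℝ≥0 → Ω → ℝ) (ν : Measure ℝ) : Prop extends IsSubordinator P X where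
  levy_nonpos : ν (Iic 0) = 0
  levy_integrable : ∫⁻ z, ENNReal.ofReal (min z 1) ∂ν < ∞
  laplace : ∀ u : ℂ, 0 ≤ u.re →
    ∫ ω, Complex.exp (-u * (X 1 ω : ℂ)) ∂P = Complex.exp (laplaceExponent ν u)

/-! ### Lévy measure and Blumenthal–Getoor index of a Lévy process -/

/-- `η` is the Lévy measure in the Lévy–Khintchine triplet `(b, c, η)` of the law of `X 1`. -/
def IsLevyMeasureOf {Ω : Type u} [MeasurableSpace Ω] (P : Measure Ω)
    (X : ℝ≥0 → Ω → ℝ) (η : Measure ℝ) : Prop :=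
  η {0} = 0 ∧ ∫⁻ z, ENNReal.ofReal (min (z ^ 2) 1) ∂η < ∞ ∧
    ∃ (b : ℝ) (c : ℝ≥0), ∀ u : ℝ,
      ∫ ω, Complex.exp (Complex.I * (u : ℂ) * (X 1 ω : ℂ)) ∂P =
        Complex.exp (Complex.I * (b : ℂ) * (u : ℂ) - ((c : ℝ) : ℂ) * (u : ℂ) ^ 2 / 2 +
          ∫ z, (Complex.exp (Complex.I * (u : ℂ) * (z : ℂ)) - 1 -
            (Icc (-1 : ℝ) 1).indicator (fun z : ℝ => Complex.I * (u : ℂ) * (z : ℂ)) z) ∂η)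

open Classical in
/-- The Lévy measure of a Lévy process (`0` by convention if there is none; for a Lévy process it
exists and is unique by the Lévy–Khintchine theorem). -/
noncomputable def levyMeasure {Ω : Type u} [MeasurableSpace Ω] (P : Measure Ω)
    (X : ℝ≥0 → Ω → ℝ) : Measure ℝ :=
  if h : ∃ η, IsLevyMeasureOf P X η then h.choose else 0

/-- The Blumenthal–Getoor index
`𝔅(X) = inf {p > 0 : ∫_{[-1,1]} |z|^p ν_X(dz) < ∞}`. -/
noncomputable def blumenthalGetoor {Ω : Type u} [MeasurableSpace Ω] (P : Measure Ω)
    (X : ℝ≥0 → Ω → ℝ) : ℝ :=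
  sInf {p : ℝ | 0 < p ∧ ∫⁻ z in Icc (-1 : ℝ) 1, ENNReal.ofReal (|z| ^ p) ∂(levyMeasure P X) < ∞}

/-! ### Regulated clocks -/

/-- Running average of a path, with value `0` at time `0`. -/
noncomputable def runningAverage (f : ℝ≥0 → ℝ) (t : ℝ≥0) : ℝ :=
  (t : ℝ)⁻¹ * ∫ s in (0 : ℝ)..(t : ℝ), f s.toNNReal

/-- The running average iterated `k` times. -/
noncomputable def iteratedAverage (f : ℝ≥0 → ℝ) : ℕ → ℝ≥0 → ℝ
  | 0 => f
  | k + 1 => runningAverage (iteratedAverage f k)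

/-- The integral from `0` iterated `k` times. -/
noncomputable def iteratedIntegral (f : ℝ≥0 → ℝ) : ℕ → ℝ≥0 → ℝ
  | 0 => f
  | k + 1 => fun t => ∫ s in (0 : ℝ)..(t : ℝ), iteratedIntegral f k s.toNNReal

/-- The subordinator `V` is induced by the process `A`: `V t` and `A t` have the same law for
every `t`. The two processes may live on different probability spaces. -/
def IsInducedBy {Ω Ω' : Type u} [MeasurableSpace Ω] [MeasurableSpace Ω']
    (P : Measure Ω) (A : ℝ≥0 → Ω → ℝ) (P' : Measure Ω') (V : ℝ≥0 → Ω' → ℝ) : Prop :=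
  IsSubordinator P' V ∧ ∀ t, IdentDistrib (V t) (A t) P' P

/-- `Γ(n, a) = ∫_a^∞ x^{n-1} e^{-x} dx`. -/
noncomputable def upperIncompleteGamma (n a : ℝ) : ℝ :=
  ∫ x in Ioi a, x ^ (n - 1) * Real.exp (-x)

/-- The subordinator `V` has Laplace transform `E e^{-u V_t} = e^{t ψ(u)}` for `Re u ≥ 0`. -/
def HasLaplaceTransform {Ω' : Type u} [MeasurableSpace Ω'] (P' : Measure Ω')
    (V : ℝ≥0 → Ω' → ℝ) (ψ : ℂ → ℂ) : Prop :=
  IsSubordinator P' V ∧ ∀ (t : ℝ≥0) (u : ℂ), 0 ≤ u.re →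
    ∫ ω, Complex.exp (-u * (V t ω : ℂ)) ∂P' = Complex.exp (((t : ℝ) : ℂ) * ψ u)

/-- `V` is a type-I regulated `X`-clock of real degree `n > 0`: for an integer degree `k ≥ 1` it is
the subordinator induced by the `k`-th iterated running average of the paths of `X`, and for
other degrees it is given by the extension of the Laplace transform to real `n > 0`. -/
def IsTypeIClock {Ω Ω' : Type u} [MeasurableSpace Ω] [MeasurableSpace Ω']
    (P : Measure Ω) (X : ℝ≥0 → Ω → ℝ) (ν : Measure ℝ) (n : ℝ)
    (P' : Measure Ω') (V : ℝ≥0 → Ω' → ℝ) : Prop :=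
  (∃ k : ℕ, 1 ≤ k ∧ n = k ∧ IsInducedBy P (fun t ω => iteratedAverage (fun s => X s ω) k t) P' V) ∨
  (0 < n ∧ (∀ k : ℕ, n ≠ k) ∧ HasLaplaceTransform P' V (fun u => ∫ s in (0 : ℝ)..1,
    laplaceExponent ν
      (((1 - upperIncompleteGamma n (-Real.log s) / Real.Gamma n : ℝ) : ℂ) * u)))

/-- The type-II recipe: `Y⁽⁰⁾ = X`, and `Y⁽ᵏ⁺¹⁾` is the subordinator induced by the running average
of the subordinator `Y⁽ᵏ⁾`. -/
inductive IsTypeIIRecipe {Ω : Type u} [MeasurableSpace Ω] (P : Measure Ω) (X : ℝ≥0 → Ω → ℝ) :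
    ℕ → ∀ (Ω' : Type u) [MeasurableSpace Ω'], Measure Ω' → (ℝ≥0 → Ω' → ℝ) → Prop
  | zero : IsTypeIIRecipe P X 0 Ω P X
  | succ (k : ℕ) (Ω₁ Ω₂ : Type u) [MeasurableSpace Ω₁] [MeasurableSpace Ω₂]
      (P₁ : Measure Ω₁) (P₂ : Measure Ω₂) (Y : ℝ≥0 → Ω₁ → ℝ) (V : ℝ≥0 → Ω₂ → ℝ) :
      IsTypeIIRecipe P X k Ω₁ P₁ Y →
      IsInducedBy P₁ (fun t ω => runningAverage (fun s => Y s ω) t) P₂ V →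
      IsTypeIIRecipe P X (k + 1) Ω₂ P₂ V

/-- `V` is a type-II regulated `X`-clock of real degree `n > 0`. -/
def IsTypeIIClock {Ω Ω' : Type u} [MeasurableSpace Ω] [MeasurableSpace Ω']
    (P : Measure Ω) (X : ℝ≥0 → Ω → ℝ) (ν : Measure ℝ) (n : ℝ)
    (P' : Measure Ω') (V : ℝ≥0 → Ω' → ℝ) : Prop :=
  (∃ k : ℕ, 1 ≤ k ∧ n = k ∧ IsTypeIIRecipe P X k Ω' P' V) ∨
  (0 < n ∧ (∀ k : ℕ, n ≠ k) ∧ HasLaplaceTransform P' V (fun u =>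
    ((Real.Gamma n : ℝ) : ℂ)⁻¹ * ∫ v in (0 : ℝ)..1,
      (((-Real.log v) ^ (n - 1) : ℝ) : ℂ) * laplaceExponent ν (u * (v : ℂ))))

/-- `V` is a type-III regulated `X`-clock of real degree `n > 0`: for an integer degree `k ≥ 1` it
is induced by `t^{-k}` times the `k`-fold iterated integral of `X`. -/
def IsTypeIIIClock {Ω Ω' : Type u} [MeasurableSpace Ω] [MeasurableSpace Ω']
    (P : Measure Ω) (X : ℝ≥0 → Ω → ℝ) (ν : Measure ℝ) (n : ℝ)
    (P' : Measure Ω') (V : ℝ≥0 → Ω' → ℝ) : Prop :=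
  (∃ k : ℕ, 1 ≤ k ∧ n = k ∧
    IsInducedBy P (fun t ω => ((t : ℝ) ^ k)⁻¹ * iteratedIntegral (fun s => X s ω) k t) P' V) ∨
  (0 < n ∧ (∀ k : ℕ, n ≠ k) ∧ HasLaplaceTransform P' V (fun u => ∫ s in (0 : ℝ)..1,
    laplaceExponent ν (((s ^ n / Real.Gamma (n + 1) : ℝ) : ℂ) * u)))

/-! ### Gaussian mixtures -/

/-- `W` is a standard Brownian motion independent of the clock `V`. -/
structure IsIndepBrownian {Ω : Type u} [MeasurableSpace Ω] (P : Measure Ω)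
    (V W : ℝ≥0 → Ω → ℝ) : Prop where
  measurable : ∀ t, Measurable (W t)
  brownian : IsBrownianReal W P
  indep : IndepFun (fun ω t => V t ω) (fun ω t => W t ω) P

/-- The Gaussian mixture `Ξ_t = μ t + θ V_t + W_{V_t}` built on the clock `V`. -/
noncomputable def gaussianMixture {Ω : Type u} (μ θ : ℝ) (V W : ℝ≥0 → Ω → ℝ) :
    ℝ≥0 → Ω → ℝ :=
  fun t ω => μ * (t : ℝ) + θ * V t ω + W (V t ω).toNNReal ω

/-! The index depends only on which powers `min(|z|, 1)^p` the Lévy measure integrates, and two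
operations on Lévy measures have to be followed.

Regulating a clock rescales jumps at random: the new Lévy measure is the image of `ν ⊗ κ` under `(z,
s) ↦ z k(s)`, with `κ` finite and `k` bounded, nonnegative and not almost everywhere zero. Such a
rescaling changes the truncated `p`-th moments only by constants, so the set of admissible exponents
is unchanged (`bgSet_scaledMeasure`). In non-integer degree this form is read off the Laplace
transform. In integer degree the average at time `1` is `∫ X_s m(ds)` for a finite measure `m` on
`(0, 1]`, and summation by parts over the independent increments of `X` gives the exponent `∫_0^1
ψ(m((s, ∞)) u) ds` (`integral_exp_integral_subordinator`). Type II repeats one such step on a new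
subordinator each time.

Brownian subordination sends a jump `y` of the clock to a Gaussian jump `θ y + √y w`. For small `y`
its size is of order `√y`, so exponent `p` for the mixture corresponds to `p / 2` for the clock,
whatever `θ` is (`lintegral_mixtureMeasure_lt_top_iff`); this is the factor `2`.

Since `levyMeasure` is chosen among all Lévy measures of a process, it must also be shown that any
two give the same exponents (`IsLevyMeasureOf.bgSet_eq`). -/

/-- The exponents `p > 0` for which `|z|^p` is integrable near `0`. -/
def bgSet (η : Measure ℝ) : Set ℝ :=
  {p : ℝ | 0 < p ∧ ∫⁻ z in Icc (-1 : ℝ) 1, ENNReal.ofReal (|z| ^ p) ∂η < ∞}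

/-- Measures carried by `[0, ∞)` that integrate `z ∧ 1`. -/
structure IsSubordinatorMeasure (ρ : Measure ℝ) : Prop where
  ae_nonneg : ∀ᵐ z ∂ρ, 0 ≤ z
  lintegral_lt_top : ∫⁻ z, ENNReal.ofReal (min z 1) ∂ρ < ∞

/-! ### Truncated moments and finiteness away from the origin -/

theorem measure_one_lt_abs_lt_top {η : Measure ℝ}
    (hη : ∫⁻ z, ENNReal.ofReal (min (z ^ 2) 1) ∂η < ∞) : η (Icc (-1 : ℝ) 1)ᶜ < ∞ := by
  refine lt_of_le_of_lt ?_ hη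
  rw [← lintegral_indicator_one measurableSet_Icc.compl]
  refine lintegral_mono fun z => ?_
  by_cases hz : z ∈ (Icc (-1 : ℝ) 1)ᶜ
  · rw [indicator_of_mem hz]
    have : (1 : ℝ) ≤ z ^ 2 := by
      rw [mem_compl_iff, mem_Icc, not_and_or, not_le, not_le] at hz
      rcases hz with h | h <;> nlinarith
    simp [min_eq_right this]
  · simp [indicator_of_notMem hz]

/-- The mass outside `[-1, 1]` is finite, so truncating `|z|` at `1` can replace restricting the
domain. The global form is the one that passes through image measures. -/
theorem mem_bgSet_iff {η : Measure ℝ} (hη : ∫⁻ z, ENNReal.ofReal (min (z ^ 2) 1) ∂η < ∞) (p : ℝ) :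
    p ∈ bgSet η ↔ 0 < p ∧ ∫⁻ z, ENNReal.ofReal ((min |z| 1) ^ p) ∂η < ∞ := by
  refine and_congr_right fun hp => ?_
  rw [← lintegral_add_compl (fun z => ENNReal.ofReal ((min |z| 1) ^ p)) measurableSet_Icc
    (A := Icc (-1 : ℝ) 1)]
  have h1 : ∫⁻ z in Icc (-1 : ℝ) 1, ENNReal.ofReal ((min |z| 1) ^ p) ∂η =
      ∫⁻ z in Icc (-1 : ℝ) 1, ENNReal.ofReal (|z| ^ p) ∂η := by
    refine setLIntegral_congr_fun measurableSet_Icc fun z hz => ?_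
    have : |z| ≤ 1 := abs_le.2 hz
    simp [min_eq_left this]
  have h2 : ∫⁻ z in (Icc (-1 : ℝ) 1)ᶜ, ENNReal.ofReal ((min |z| 1) ^ p) ∂η < ∞ := by
    refine lt_of_le_of_lt (lintegral_mono (g := fun _ => 1) fun z => ?_) ?_
    · simp only [ENNReal.ofReal_le_one]
      exact Real.rpow_le_one (le_min (abs_nonneg _) zero_le_one) (min_le_right _ _) hp.le
    · simpa using measure_one_lt_abs_lt_top hη
  rw [h1, ENNReal.add_lt_top]
  exact ⟨fun h => ⟨h, h2⟩, fun h => h.1⟩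

theorem IsSubordinatorMeasure.lintegral_sq_lt_top {ρ : Measure ℝ} (hρ : IsSubordinatorMeasure ρ) :
    ∫⁻ z, ENNReal.ofReal (min (z ^ 2) 1) ∂ρ < ∞ := by
  refine lt_of_le_of_lt (lintegral_mono_ae ?_) hρ.lintegral_lt_top
  filter_upwards [hρ.ae_nonneg] with z hz
  refine ENNReal.ofReal_le_ofReal ?_
  rcases le_total z 1 with h | h
  · rw [min_eq_left h]
    exact (min_le_left _ _).trans (by nlinarith)
  · rw [min_eq_right h]
    exact min_le_right _ _

/-- Weighting `ν` by `min z 1` gives a finite measure, and the weight is positive almost everywhere,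
so it can be inverted. This makes product measures and Fubini available for `ν`. -/
theorem sFinite_of_lintegral_min {ν : Measure ℝ} (h0 : ν (Iic 0) = 0)
    (h : ∫⁻ z, ENNReal.ofReal (min z 1) ∂ν < ∞) : SFinite ν := by
  set f : ℝ → ℝ≥0∞ := fun z => ENNReal.ofReal (min z 1)
  have hf : Measurable f := by fun_prop
  have hne : ∀ᵐ z ∂ν, f z ≠ 0 := by
    have : ∀ᵐ z ∂ν, z ∉ Iic (0 : ℝ) := measure_eq_zero_iff_ae_notMem.1 h0
    filter_upwards [this] with z hz
    have hz' : 0 < z := not_le.1 hz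
    simpa [f] using hz'
  have := withDensity_inv_same hf hne (Eventually.of_forall fun z => ENNReal.ofReal_ne_top)
  rw [← this]
  have : IsFiniteMeasure (ν.withDensity f) := isFiniteMeasure_withDensity h.ne
  infer_instance

/-! ### Laplace exponents -/

theorem norm_exp_neg_sub_one_le {w : ℂ} (hw : 0 ≤ w.re) : ‖Complex.exp (-w) - 1‖ ≤ 2 ∧
    ‖Complex.exp (-w) - 1‖ ≤ 2 * ‖w‖ := by
  have h2 : ‖Complex.exp (-w) - 1‖ ≤ 2 := by
    refine (norm_sub_le _ _).trans ?_
    have : ‖Complex.exp (-w)‖ ≤ 1 := by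
      rw [Complex.norm_exp]; simpa using hw
    simp only [norm_one]; linarith
  refine ⟨h2, ?_⟩
  rcases le_total ‖w‖ 1 with h | h
  · simpa using Complex.norm_exp_sub_one_le (x := -w) (by simpa using h)
  · linarith

theorem norm_laplace_kernel_le {u : ℂ} (hu : 0 ≤ u.re) {z : ℝ} (hz : 0 ≤ z) :
    ‖Complex.exp (-u * z) - 1‖ ≤ 2 * (‖u‖ + 1) * min z 1 := by
  have hre : 0 ≤ (u * z).re := by simpa using mul_nonneg hu hz
  obtain ⟨h1, h2⟩ := norm_exp_neg_sub_one_le hre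
  rw [← neg_mul] at h1 h2
  have hn := norm_nonneg u
  rcases le_total z 1 with h | h
  · rw [min_eq_left h]
    refine h2.trans ?_
    rw [norm_mul, Complex.norm_real, Real.norm_of_nonneg hz]
    nlinarith
  · rw [min_eq_right h]
    linarith

theorem IsSubordinatorMeasure.integrable_min {ρ : Measure ℝ} (hρ : IsSubordinatorMeasure ρ) :
    Integrable (fun z : ℝ => min z 1) ρ := by
  refine ⟨by fun_prop, ?_⟩
  rw [hasFiniteIntegral_iff_ofReal]
  · exact hρ.lintegral_lt_top
  · filter_upwards [hρ.ae_nonneg] with z hz using le_min hz zero_le_one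

theorem IsSubordinatorMeasure.integrable_kernel {ρ : Measure ℝ} (hρ : IsSubordinatorMeasure ρ)
    {u : ℂ} (hu : 0 ≤ u.re) : Integrable (fun z : ℝ => Complex.exp (-u * z) - 1) ρ := by
  refine (hρ.integrable_min.const_mul (2 * (‖u‖ + 1))).mono' (by fun_prop) ?_
  filter_upwards [hρ.ae_nonneg] with z hz using norm_laplace_kernel_le hu hz

theorem IsSubordinatorMeasure.norm_laplaceExponent_le {ρ : Measure ℝ}
    (hρ : IsSubordinatorMeasure ρ) {u : ℂ} (hu : 0 ≤ u.re) :
    ‖laplaceExponent ρ u‖ ≤ 2 * (‖u‖ + 1) * ∫ z, min z 1 ∂ρ := by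
  rw [← integral_const_mul]
  refine norm_integral_le_of_norm_le (hρ.integrable_min.const_mul _) ?_
  filter_upwards [hρ.ae_nonneg] with z hz using norm_laplace_kernel_le hu hz

theorem IsSubordinatorMeasure.continuousOn_laplaceExponent {ρ : Measure ℝ}
    (hρ : IsSubordinatorMeasure ρ) : ContinuousOn (laplaceExponent ρ) {u | 0 ≤ u.re} := by
  intro u hu
  refine tendsto_integral_filter_of_dominated_convergence
    (fun z => 2 * ((‖u‖ + 1) + 1) * min z 1) ?_ ?_ (hρ.integrable_min.const_mul _) ?_
  · exact Eventually.of_forall fun w => by fun_prop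
  · have : ∀ᶠ w in 𝓝[{u : ℂ | 0 ≤ u.re}] u, ‖w‖ < ‖u‖ + 1 :=
      nhdsWithin_le_nhds (continuous_norm.continuousAt.eventually_lt_const (by simp))
    filter_upwards [this, self_mem_nhdsWithin] with w hw hw'
    filter_upwards [hρ.ae_nonneg] with z hz
    refine (norm_laplace_kernel_le hw' hz).trans ?_
    have : 0 ≤ min z 1 := le_min hz zero_le_one
    gcongr
  · refine Eventually.of_forall fun z => ?_
    have : Continuous fun w : ℂ => Complex.exp (-w * z) - 1 := by fun_prop
    exact this.continuousAt.tendsto.mono_left nhdsWithin_le_nhds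

@[simp] theorem laplaceExponent_zero (ρ : Measure ℝ) : laplaceExponent ρ 0 = 0 := by
  simp [laplaceExponent]

/-! ### Random rescaling of a Lévy measure -/

/-- The image of `ρ ⊗ κ` under `(z, s) ↦ z k(s)`. -/
noncomputable def scaledMeasure (ρ κ : Measure ℝ) (k : ℝ → ℝ) : Measure ℝ :=
  (ρ.prod κ).map fun p => p.1 * k p.2

section Scaled

variable {ρ κ : Measure ℝ} {k : ℝ → ℝ} {C : ℝ}

instance [SFinite ρ] [SFinite κ] : SFinite (scaledMeasure ρ κ k) := by
  unfold scaledMeasure; infer_instance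

theorem min_mul_le {z k C : ℝ} (hz : 0 ≤ z) (hk : k ≤ C) :
    min (z * k) 1 ≤ max C 1 * min z 1 := by
  rcases le_total z 1 with h | h
  · rw [min_eq_left h]
    refine (min_le_left _ _).trans ?_
    rw [mul_comm]
    exact mul_le_mul_of_nonneg_right (hk.trans (le_max_left _ _)) hz
  · rw [min_eq_right h, mul_one]
    exact (min_le_right _ _).trans (le_max_right _ _)

theorem le_min_mul {z k ε : ℝ} (hz : 0 ≤ z) (hε0 : 0 ≤ ε) (hε : ε ≤ 1) (hk : ε ≤ k) :
    ε * min z 1 ≤ min (z * k) 1 := by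
  refine le_min ?_ ?_
  · rw [mul_comm z]
    exact mul_le_mul hk (min_le_left _ _) (le_min hz zero_le_one) (hε0.trans hk)
  · exact (mul_le_mul_of_nonneg_left (min_le_right _ _) hε0).trans (by simpa using hε)

theorem ae_prod_of_ae [SFinite ρ] [SFinite κ] {p q : ℝ → Prop} (h : ∀ᵐ z ∂ρ, p z)
    (h' : ∀ᵐ s ∂κ, q s) : ∀ᵐ x ∂(ρ.prod κ), p x.1 ∧ q x.2 :=
  (Measure.quasiMeasurePreserving_fst.ae h).and (Measure.quasiMeasurePreserving_snd.ae h')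

theorem IsSubordinatorMeasure.scaled [SFinite ρ] [IsFiniteMeasure κ] (hρ : IsSubordinatorMeasure ρ)
    (hk : Measurable k) (hkC : ∀ᵐ s ∂κ, 0 ≤ k s ∧ k s ≤ C) :
    IsSubordinatorMeasure (scaledMeasure ρ κ k) := by
  have hm : Measurable fun p : ℝ × ℝ => p.1 * k p.2 := by fun_prop
  have hae := ae_prod_of_ae hρ.ae_nonneg hkC
  refine ⟨?_, ?_⟩
  · refine (ae_map_iff hm.aemeasurable (measurableSet_le measurable_const measurable_id)).2 ?_
    filter_upwards [hae] with x hx using mul_nonneg hx.1 hx.2.1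
  · rw [scaledMeasure, lintegral_map (by fun_prop) hm]
    calc ∫⁻ a, ENNReal.ofReal (min (a.1 * k a.2) 1) ∂(ρ.prod κ)
        ≤ ∫⁻ a, (ENNReal.ofReal (max C 1) * ENNReal.ofReal (min a.1 1)) * 1 ∂(ρ.prod κ) := by
          refine lintegral_mono_ae ?_
          filter_upwards [hae] with x hx
          rw [mul_one, ← ENNReal.ofReal_mul (by positivity)]
          exact ENNReal.ofReal_le_ofReal (min_mul_le hx.1 hx.2.2)
      _ = (∫⁻ z, ENNReal.ofReal (max C 1) * ENNReal.ofReal (min z 1) ∂ρ) * ∫⁻ _, 1 ∂κ :=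
          lintegral_prod_mul (f := fun z => ENNReal.ofReal (max C 1) * ENNReal.ofReal (min z 1))
            (g := fun _ => 1) (by fun_prop) (by fun_prop)
      _ < ∞ := by
          rw [lintegral_const_mul _ (by fun_prop)]
          refine ENNReal.mul_lt_top (ENNReal.mul_lt_top ENNReal.ofReal_lt_top hρ.lintegral_lt_top) ?_
          simp

/-- Scaling the jump by `k s` in `exp(-u z)` is the same as scaling `u`; the rest is Fubini. -/
theorem laplaceExponent_scaledMeasure [SFinite ρ] [IsFiniteMeasure κ]
    (hρ : IsSubordinatorMeasure ρ) (hk : Measurable k) (hkC : ∀ᵐ s ∂κ, 0 ≤ k s ∧ k s ≤ C) {u : ℂ}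
    (hu : 0 ≤ u.re) :
    laplaceExponent (scaledMeasure ρ κ k) u = ∫ s, laplaceExponent ρ ((k s : ℂ) * u) ∂κ := by
  have hm : Measurable fun p : ℝ × ℝ => p.1 * k p.2 := by fun_prop
  have hint := (hρ.scaled hk hkC).integrable_kernel hu
  have hsm : AEStronglyMeasurable (fun z : ℝ => Complex.exp (-u * z) - 1)
      (Measure.map (fun p : ℝ × ℝ => p.1 * k p.2) (ρ.prod κ)) := by fun_prop
  rw [scaledMeasure, integrable_map_measure hsm hm.aemeasurable] at hint
  rw [laplaceExponent, scaledMeasure, integral_map hm.aemeasurable hsm]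
  refine (integral_prod_symm _ hint).trans ?_
  refine integral_congr_ae (Eventually.of_forall fun s => ?_)
  refine integral_congr_ae (Eventually.of_forall fun z => ?_)
  simp only [Function.comp_apply, Complex.ofReal_mul]
  congr 2
  ring

/-- Two-sided comparison: `min (z k) 1 ≤ max C 1 * min z 1` always, and `ε * min z 1 ≤ min (z k) 1`
where `k ≥ ε`. Both bounds factor over the product measure. -/
theorem bgSet_scaledMeasure [SFinite ρ] [IsFiniteMeasure κ]
    (hρ : IsSubordinatorMeasure ρ) (hk : Measurable k) (hkC : ∀ᵐ s ∂κ, 0 ≤ k s ∧ k s ≤ C)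
    (hpos : κ {s | 0 < k s} ≠ 0) : bgSet (scaledMeasure ρ κ k) = bgSet ρ := by
  have hm : Measurable fun p : ℝ × ℝ => p.1 * k p.2 := by fun_prop
  have hae := ae_prod_of_ae hρ.ae_nonneg hkC
  -- `{0 < k}` is covered by the countably many sets `{1 / (n + 1) ≤ k}`, so one of them has
  -- positive measure.
  obtain ⟨ε, hε0, hε1, hε⟩ : ∃ ε : ℝ, 0 < ε ∧ ε ≤ 1 ∧ κ {s | ε ≤ k s} ≠ 0 := by
    by_contra! hcon
    refine hpos ?_
    have : {s | 0 < k s} ⊆ ⋃ n : ℕ, {s | 1 / ((n : ℝ) + 1) ≤ k s} := by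
      intro s hs
      obtain ⟨n, hn⟩ := exists_nat_one_div_lt (mem_ofPred.1 hs)
      exact mem_iUnion.2 ⟨n, hn.le⟩
    refine measure_mono_null this (measure_iUnion_null fun n => hcon _ (by positivity) ?_)
    rw [div_le_one (by positivity)]
    linarith [(Nat.cast_nonneg n : (0 : ℝ) ≤ n)]
  have hAm : MeasurableSet {s | ε ≤ k s} := measurableSet_le measurable_const hk
  ext p
  rw [mem_bgSet_iff (hρ.scaled hk hkC).lintegral_sq_lt_top, mem_bgSet_iff hρ.lintegral_sq_lt_top]
  refine and_congr_right fun hp => ?_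
  rw [scaledMeasure, lintegral_map (by fun_prop) hm]
  constructor
  · intro h
    have h1 : (∫⁻ z, ENNReal.ofReal (ε ^ p) * ENNReal.ofReal ((min |z| 1) ^ p) ∂ρ) *
        ∫⁻ s, {s | ε ≤ k s}.indicator 1 s ∂κ < ∞ := by
      rw [← lintegral_prod_mul (by fun_prop) ((measurable_one.indicator hAm).aemeasurable)]
      refine lt_of_le_of_lt (lintegral_mono_ae ?_) h
      filter_upwards [hae] with x hx
      by_cases hs : x.2 ∈ {s | ε ≤ k s}
      · rw [indicator_of_mem hs, Pi.one_apply, mul_one, ← ENNReal.ofReal_mul (by positivity),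
          abs_of_nonneg hx.1, abs_of_nonneg (mul_nonneg hx.1 hx.2.1),
          ← Real.mul_rpow hε0.le (le_min hx.1 zero_le_one)]
        have := le_min_mul hx.1 hε0.le hε1 hs
        refine ENNReal.ofReal_le_ofReal (Real.rpow_le_rpow ?_ this hp.le)
        exact mul_nonneg hε0.le (le_min hx.1 zero_le_one)
      · simp [indicator_of_notMem hs]
    rw [lintegral_indicator_one hAm, lintegral_const_mul _ (by fun_prop)] at h1
    by_contra htop
    rw [not_lt_top_iff] at htop
    rw [htop, ENNReal.mul_top, ENNReal.top_mul hε] at h1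
    · exact lt_irrefl _ h1
    · simpa using Real.rpow_pos_of_pos hε0 p
  · intro h
    calc ∫⁻ a, ENNReal.ofReal ((min |a.1 * k a.2| 1) ^ p) ∂(ρ.prod κ)
        ≤ ∫⁻ a, (ENNReal.ofReal ((max C 1) ^ p) * ENNReal.ofReal ((min |a.1| 1) ^ p)) * 1
            ∂(ρ.prod κ) := by
          refine lintegral_mono_ae ?_
          filter_upwards [hae] with x hx
          rw [mul_one, ← ENNReal.ofReal_mul (by positivity), abs_of_nonneg hx.1,
            abs_of_nonneg (mul_nonneg hx.1 hx.2.1),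
            ← Real.mul_rpow (by positivity) (le_min hx.1 zero_le_one)]
          refine ENNReal.ofReal_le_ofReal (Real.rpow_le_rpow ?_ (min_mul_le hx.1 hx.2.2) hp.le)
          exact le_min (mul_nonneg hx.1 hx.2.1) zero_le_one
      _ = (∫⁻ z, ENNReal.ofReal ((max C 1) ^ p) * ENNReal.ofReal ((min |z| 1) ^ p) ∂ρ) *
            ∫⁻ _, 1 ∂κ :=
          lintegral_prod_mul (f := fun z => ENNReal.ofReal ((max C 1) ^ p) *
            ENNReal.ofReal ((min |z| 1) ^ p)) (g := fun _ => 1) (by fun_prop) (by fun_prop)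
      _ < ∞ := by
          rw [lintegral_const_mul _ (by fun_prop)]
          refine ENNReal.mul_lt_top (ENNReal.mul_lt_top ENNReal.ofReal_lt_top h) ?_
          simp

end Scaled

/-! ### The Lévy measure is determined near the origin -/

theorem norm_exp_I_mul_sub_le (x : ℝ) :
    ‖Complex.exp (Complex.I * x) - 1 - Complex.I * x‖ ≤ 3 * x ^ 2 := by
  have hn : ‖Complex.I * (x : ℂ)‖ = |x| := by simp
  rcases le_total |x| 1 with h | h
  · refine (Complex.norm_exp_sub_one_sub_id_le (hn.trans_le h)).trans ?_
    rw [hn, sq_abs]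
    nlinarith [sq_nonneg x]
  · refine (norm_sub_le _ _).trans ?_
    have h1 : ‖Complex.exp (Complex.I * x) - 1‖ ≤ |x| :=
      Real.norm_exp_I_mul_ofReal_sub_one_le
    rw [hn, ← sq_abs]
    nlinarith

theorem indicator_I_mul (u z : ℝ) :
    (Icc (-1 : ℝ) 1).indicator (fun z : ℝ => Complex.I * (u : ℂ) * (z : ℂ)) z =
      Complex.I * (u : ℂ) * (((Icc (-1 : ℝ) 1).indicator (fun z => z) z : ℝ) : ℂ) := by
  by_cases hz : z ∈ Icc (-1 : ℝ) 1
  · simp [indicator_of_mem hz]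
  · simp [indicator_of_notMem hz]

theorem norm_levyKernel_le (u z : ℝ) :
    ‖Complex.exp (Complex.I * (u : ℂ) * (z : ℂ)) - 1 -
      (Icc (-1 : ℝ) 1).indicator (fun z : ℝ => Complex.I * (u : ℂ) * (z : ℂ)) z‖ ≤
      (3 * u ^ 2 + 2) * min (z ^ 2) 1 := by
  have hx : Complex.I * (u : ℂ) * (z : ℂ) = Complex.I * ((u * z : ℝ) : ℂ) := by
    push_cast; ring
  by_cases hz : z ∈ Icc (-1 : ℝ) 1
  · rw [indicator_of_mem hz, hx]
    have h1 : z ^ 2 ≤ 1 := by rw [sq_le_one_iff_abs_le_one]; exact abs_le.2 hz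
    rw [min_eq_left h1]
    refine (norm_exp_I_mul_sub_le _).trans ?_
    nlinarith [sq_nonneg z]
  · rw [indicator_of_notMem hz, hx, sub_zero]
    have h1 : 1 ≤ z ^ 2 := by
      rw [one_le_sq_iff_one_le_abs]
      by_contra! h
      exact hz (abs_le.1 h.le)
    rw [min_eq_right h1]
    refine (norm_sub_le _ _).trans ?_
    rw [mul_comm, Complex.norm_exp_ofReal_mul_I, norm_one]
    nlinarith [sq_nonneg u]

theorem integrable_min_sq {η : Measure ℝ} (hη : ∫⁻ z, ENNReal.ofReal (min (z ^ 2) 1) ∂η < ∞) :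
    Integrable (fun z : ℝ => min (z ^ 2) 1) η := by
  refine ⟨by fun_prop, ?_⟩
  rw [hasFiniteIntegral_iff_ofReal (Eventually.of_forall fun z => by positivity)]
  exact hη

theorem measurable_levyKernel (u : ℝ) : Measurable fun z : ℝ =>
    Complex.exp (Complex.I * (u : ℂ) * (z : ℂ)) - 1 -
      (Icc (-1 : ℝ) 1).indicator (fun z : ℝ => Complex.I * (u : ℂ) * (z : ℂ)) z := by
  refine Measurable.sub (by fun_prop) (Measurable.indicator (by fun_prop) measurableSet_Icc)

theorem integrable_levyKernel {η : Measure ℝ}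
    (hη : ∫⁻ z, ENNReal.ofReal (min (z ^ 2) 1) ∂η < ∞) (u : ℝ) :
    Integrable (fun z : ℝ => Complex.exp (Complex.I * (u : ℂ) * (z : ℂ)) - 1 -
      (Icc (-1 : ℝ) 1).indicator (fun z : ℝ => Complex.I * (u : ℂ) * (z : ℂ)) z) η :=
  ((integrable_min_sq hη).const_mul _).mono' (measurable_levyKernel u).aestronglyMeasurable
    (Eventually.of_forall fun z => norm_levyKernel_le u z)

theorem re_levyKernel (u z : ℝ) :
    (Complex.exp (Complex.I * (u : ℂ) * (z : ℂ)) - 1 -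
      (Icc (-1 : ℝ) 1).indicator (fun z : ℝ => Complex.I * (u : ℂ) * (z : ℂ)) z).re =
      Real.cos (u * z) - 1 := by
  have h1 : (Complex.exp (Complex.I * (u : ℂ) * (z : ℂ))).re = Real.cos (u * z) := by
    rw [show Complex.I * (u : ℂ) * (z : ℂ) = ((u * z : ℝ) : ℂ) * Complex.I by push_cast; ring,
      Complex.exp_ofReal_mul_I_re]
  have h2 : ((Icc (-1 : ℝ) 1).indicator (fun z : ℝ => Complex.I * (u : ℂ) * (z : ℂ)) z).re = 0 := by
    by_cases hz : z ∈ Icc (-1 : ℝ) 1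
    · simp [indicator_of_mem hz]
    · simp [indicator_of_notMem hz]
  rw [Complex.sub_re, Complex.sub_re, h1, h2, Complex.one_re, sub_zero]

theorem integrable_cos_sub_one {η : Measure ℝ}
    (hη : ∫⁻ z, ENNReal.ofReal (min (z ^ 2) 1) ∂η < ∞) (u : ℝ) :
    Integrable (fun z : ℝ => Real.cos (u * z) - 1) η := by
  have := (integrable_levyKernel hη u).re
  refine this.congr (Eventually.of_forall fun z => ?_)
  exact re_levyKernel u z

/-- Taking the modulus removes the drift and leaves a real exponential, which can be inverted
without choosing a branch of the logarithm. -/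
theorem norm_exp_levyExponent {η : Measure ℝ}
    (hη : ∫⁻ z, ENNReal.ofReal (min (z ^ 2) 1) ∂η < ∞) (b : ℝ) (c : ℝ≥0) (u : ℝ) :
    ‖Complex.exp (Complex.I * (b : ℂ) * (u : ℂ) - ((c : ℝ) : ℂ) * (u : ℂ) ^ 2 / 2 +
          ∫ z, (Complex.exp (Complex.I * (u : ℂ) * (z : ℂ)) - 1 -
            (Icc (-1 : ℝ) 1).indicator (fun z : ℝ => Complex.I * (u : ℂ) * (z : ℂ)) z) ∂η)‖ =
      Real.exp (-(c * u ^ 2 / 2) + ∫ z, (Real.cos (u * z) - 1) ∂η) := by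
  rw [Complex.norm_exp, Complex.add_re]
  congr 2
  · rw [Complex.sub_re, show Complex.I * (b : ℂ) * (u : ℂ) = Complex.I * ((b * u : ℝ) : ℂ) by
      push_cast; ring, show ((c : ℝ) : ℂ) * (u : ℂ) ^ 2 / 2 = ((c * u ^ 2 / 2 : ℝ) : ℂ) by
      push_cast; ring, Complex.ofReal_re, Complex.I_mul_re, Complex.ofReal_im]
    ring
  · refine (integral_re (integrable_levyKernel hη u)).symm.trans ?_
    exact integral_congr_ae (Eventually.of_forall fun z => re_levyKernel u z)

/-- The finite measure `2 (1 - cos z) η(dz) + c δ₀`. -/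
noncomputable def cosMeasure (η : Measure ℝ) (c : ℝ≥0) : Measure ℝ :=
  η.withDensity (fun z => ((2 * (1 - Real.cos z)).toNNReal : ℝ≥0∞)) + c • Measure.dirac 0

theorem two_mul_one_sub_cos_nonneg (z : ℝ) : 0 ≤ 2 * (1 - Real.cos z) := by
  linarith [Real.cos_le_one z]

theorem isFiniteMeasure_cosMeasure {η : Measure ℝ}
    (hη : ∫⁻ z, ENNReal.ofReal (min (z ^ 2) 1) ∂η < ∞) (c : ℝ≥0) :
    IsFiniteMeasure (cosMeasure η c) := by
  have h : IsFiniteMeasure (η.withDensity (fun z => ((2 * (1 - Real.cos z)).toNNReal : ℝ≥0∞))) := by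
    refine isFiniteMeasure_withDensity (LT.lt.ne ?_)
    have h1 := ((integrable_cos_sub_one hη 1).const_mul (-2)).2
    rw [hasFiniteIntegral_iff_ofReal] at h1
    · convert h1 using 3 with z
      change ENNReal.ofReal _ = _
      congr 1
      ring_nf
    · refine Eventually.of_forall fun z => ?_
      simp only [Pi.zero_apply]
      linarith [Real.cos_le_one (1 * z)]
  unfold cosMeasure
  infer_instance

/-- With `R` the real part of the exponent, the right side is `2 R(u) - R(u + 1) - R(u - 1)`. Under
the integral this second difference multiplies `cos (u z)` by `2 (1 - cos z)`, and it turns `-c u² /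
2` into the constant `c`, the contribution of the atom at `0`. -/
theorem integral_cos_cosMeasure {η : Measure ℝ}
    (hη : ∫⁻ z, ENNReal.ofReal (min (z ^ 2) 1) ∂η < ∞) (c : ℝ≥0) (u : ℝ) :
    ∫ z, Real.cos (u * z) ∂(cosMeasure η c) =
      2 * (-(c * u ^ 2 / 2) + ∫ z, (Real.cos (u * z) - 1) ∂η)
      - (-(c * (u + 1) ^ 2 / 2) + ∫ z, (Real.cos ((u + 1) * z) - 1) ∂η)
      - (-(c * (u - 1) ^ 2 / 2) + ∫ z, (Real.cos ((u - 1) * z) - 1) ∂η) := by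
  have hfin := isFiniteMeasure_cosMeasure hη c
  have hint : Integrable (fun z => Real.cos (u * z)) (cosMeasure η c) :=
    (integrable_const (1 : ℝ)).mono' (by fun_prop)
      (Eventually.of_forall fun z => Real.abs_cos_le_one _)
  rw [cosMeasure] at hint ⊢
  rw [integral_add_measure hint.left_of_add_measure hint.right_of_add_measure,
    integral_withDensity_eq_integral_smul (by fun_prop), integral_smul_nnreal_measure,
    integral_dirac]
  have h : ∫ z, (2 * (1 - Real.cos z)).toNNReal • Real.cos (u * z) ∂η =
      2 * ∫ z, (Real.cos (u * z) - 1) ∂η - ∫ z, (Real.cos ((u + 1) * z) - 1) ∂η -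
        ∫ z, (Real.cos ((u - 1) * z) - 1) ∂η := by
    rw [← integral_const_mul, ← integral_sub ((integrable_cos_sub_one hη _).const_mul _)
      (integrable_cos_sub_one hη _), ← integral_sub _ (integrable_cos_sub_one hη _)]
    swap
    · exact ((integrable_cos_sub_one hη _).const_mul _).sub (integrable_cos_sub_one hη _)
    refine integral_congr_ae (Eventually.of_forall fun z => ?_)
    simp only [NNReal.smul_def, smul_eq_mul, Real.coe_toNNReal _ (two_mul_one_sub_cos_nonneg z)]
    rw [add_mul, sub_mul, one_mul, Real.cos_add, Real.cos_sub]
    ring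
  rw [h]
  simp only [NNReal.smul_def, smul_eq_mul, mul_zero, Real.cos_zero]
  ring

/-- Symmetrising cancels the sine part. Hence the cosine transform of a finite measure determines
its symmetrisation. -/
theorem charFun_add_map_neg {m : Measure ℝ} [IsFiniteMeasure m] (u : ℝ) :
    charFun (m + m.map Neg.neg) u = ((2 * ∫ z, Real.cos (u * z) ∂m : ℝ) : ℂ) := by
  have hi : ∀ v : ℝ, Integrable (fun z : ℝ => Complex.exp (v * z * Complex.I)) m := fun v => by
    refine (integrable_const (1 : ℝ)).mono' (by fun_prop) (Eventually.of_forall fun z => ?_)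
    rw [← Complex.ofReal_mul, Complex.norm_exp_ofReal_mul_I]
  have hmeas : AEStronglyMeasurable (fun z : ℝ => Complex.exp (u * z * Complex.I))
      (m.map Neg.neg) := by fun_prop
  have hi2 : Integrable (fun z : ℝ => Complex.exp (u * z * Complex.I)) (m.map Neg.neg) := by
    rw [integrable_map_measure hmeas (by fun_prop)]
    refine (hi (-u)).congr (Eventually.of_forall fun z => ?_)
    simp
  rw [charFun_apply_real, integral_add_measure (hi u) hi2, integral_map (by fun_prop) hmeas,
    ← integral_add (hi u) ?_]
  · rw [← integral_const_mul, ← integral_complex_ofReal]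
    refine integral_congr_ae (Eventually.of_forall fun z => ?_)
    simp only [Complex.ofReal_mul, Complex.ofReal_cos, Complex.ofReal_ofNat,
      Complex.two_cos]
    push_cast
    ring_nf
  · refine (hi (-u)).congr (Eventually.of_forall fun z => ?_)
    simp

/-- Undoes the density of `cosMeasure`: since `1 < 2π`, `1 - cos z` vanishes on `[-1, 1]` only at
`0`, and excluding `0` also discards the Gaussian atom. -/
theorem lintegral_cosMeasure (η : Measure ℝ) (c : ℝ≥0) (hη : η {0} = 0) (p : ℝ) :
    ∫⁻ z, (Icc (-1 : ℝ) 1 \ {0}).indicator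
      (fun z => ENNReal.ofReal (|z| ^ p) / ((2 * (1 - Real.cos z)).toNNReal : ℝ≥0∞)) z
        ∂(cosMeasure η c) = ∫⁻ z in Icc (-1 : ℝ) 1, ENNReal.ofReal (|z| ^ p) ∂η := by
  have hS : MeasurableSet (Icc (-1 : ℝ) 1 \ {0}) := measurableSet_Icc.diff (measurableSet_singleton 0)
  have hm : Measurable ((Icc (-1 : ℝ) 1 \ {0}).indicator
      (fun z => ENNReal.ofReal (|z| ^ p) / ((2 * (1 - Real.cos z)).toNNReal : ℝ≥0∞))) :=
    Measurable.indicator (by fun_prop) hS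
  rw [cosMeasure, lintegral_add_measure, lintegral_smul_measure, lintegral_dirac' _ hm,
    lintegral_withDensity_eq_lintegral_mul _ (by fun_prop) hm, ← lintegral_indicator measurableSet_Icc]
  rw [indicator_of_notMem (by simp), smul_zero, add_zero]
  have h0 : ∀ᵐ z ∂η, z ≠ 0 := by
    rw [ae_iff]; simpa using hη
  refine lintegral_congr_ae ?_
  filter_upwards [h0] with z hz
  by_cases hz1 : z ∈ Icc (-1 : ℝ) 1
  · rw [Pi.mul_apply, indicator_of_mem (mem_sdiff_of_mem hz1 hz), indicator_of_mem hz1]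
    refine ENNReal.mul_div_cancel ?_ ENNReal.coe_ne_top
    have habs : |z| ≤ 1 := abs_le.2 hz1
    have hlt : Real.cos z < 1 := by
      refine lt_of_le_of_ne (Real.cos_le_one z) fun h => hz ?_
      exact (Real.cos_eq_one_iff_of_lt_of_lt (by linarith [hz1.1, Real.pi_gt_three])
        (by linarith [hz1.2, Real.pi_gt_three])).1 h
    simpa using hlt
  · rw [Pi.mul_apply, indicator_of_notMem (fun h => hz1 h.1), indicator_of_notMem hz1, mul_zero]

theorem lintegral_add_map_neg {m : Measure ℝ} {f : ℝ → ℝ≥0∞} (hf : Measurable f)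
    (hev : ∀ z, f (-z) = f z) : ∫⁻ z, f z ∂(m + m.map Neg.neg) = 2 * ∫⁻ z, f z ∂m := by
  rw [lintegral_add_measure, lintegral_map hf measurable_neg, two_mul]
  simp [hev]

section

variable {Ω : Type u} [MeasurableSpace Ω] {P : Measure Ω} {X : ℝ≥0 → Ω → ℝ} {η η' : Measure ℝ}

/-- The moduli of the characteristic functions determine the symmetrised `cosMeasure`. That suffices
here because `|z|^p` is even; uniqueness of the whole Lévy measure is not needed. -/
theorem IsLevyMeasureOf.bgSet_eq (h : IsLevyMeasureOf P X η) (h' : IsLevyMeasureOf P X η') :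
    bgSet η = bgSet η' := by
  obtain ⟨h0, hη, b, c, hu⟩ := h
  obtain ⟨h0', hη', b', c', hu'⟩ := h'
  have hR : ∀ u : ℝ, -(c * u ^ 2 / 2) + ∫ z, (Real.cos (u * z) - 1) ∂η =
      -(c' * u ^ 2 / 2) + ∫ z, (Real.cos (u * z) - 1) ∂η' := fun u => by
    have := congrArg norm ((hu u).symm.trans (hu' u))
    rw [norm_exp_levyExponent hη, norm_exp_levyExponent hη'] at this
    exact Real.exp_injective this
  have := isFiniteMeasure_cosMeasure hη c
  have := isFiniteMeasure_cosMeasure hη' c'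
  have heq : cosMeasure η c + (cosMeasure η c).map Neg.neg =
      cosMeasure η' c' + (cosMeasure η' c').map Neg.neg := by
    refine Measure.ext_of_charFun ?_
    funext u
    rw [charFun_add_map_neg, charFun_add_map_neg, integral_cos_cosMeasure hη,
      integral_cos_cosMeasure hη', hR, hR, hR]
  have hint : ∀ p : ℝ, ∫⁻ z in Icc (-1 : ℝ) 1, ENNReal.ofReal (|z| ^ p) ∂η =
      ∫⁻ z in Icc (-1 : ℝ) 1, ENNReal.ofReal (|z| ^ p) ∂η' := fun p => by
    rw [← lintegral_cosMeasure η c h0, ← lintegral_cosMeasure η' c' h0']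
    have hm : Measurable ((Icc (-1 : ℝ) 1 \ {0}).indicator
        (fun z => ENNReal.ofReal (|z| ^ p) / ((2 * (1 - Real.cos z)).toNNReal : ℝ≥0∞))) :=
      Measurable.indicator (by fun_prop) (measurableSet_Icc.diff (measurableSet_singleton 0))
    have hev : ∀ z, (Icc (-1 : ℝ) 1 \ {0}).indicator
        (fun z => ENNReal.ofReal (|z| ^ p) / ((2 * (1 - Real.cos z)).toNNReal : ℝ≥0∞)) (-z) =
        (Icc (-1 : ℝ) 1 \ {0}).indicator
        (fun z => ENNReal.ofReal (|z| ^ p) / ((2 * (1 - Real.cos z)).toNNReal : ℝ≥0∞)) z := by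
      intro z
      have hiff : -z ∈ Icc (-1 : ℝ) 1 \ {0} ↔ z ∈ Icc (-1 : ℝ) 1 \ {0} := by
        simp only [Set.mem_sdiff, mem_Icc, mem_singleton_iff, neg_eq_zero]
        constructor <;> rintro ⟨⟨a, b⟩, c⟩ <;> exact ⟨⟨by linarith, by linarith⟩, c⟩
      by_cases hz : z ∈ Icc (-1 : ℝ) 1 \ {0}
      · rw [indicator_of_mem hz, indicator_of_mem (hiff.2 hz), abs_neg, Real.cos_neg]
      · rw [indicator_of_notMem hz, indicator_of_notMem (fun h => hz (hiff.1 h))]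
    have h2 := lintegral_add_map_neg (m := cosMeasure η c) hm hev
    rw [heq, lintegral_add_map_neg hm hev] at h2
    exact ((ENNReal.mul_right_inj (by simp) (by simp)).1 h2).symm
  ext p
  simp only [bgSet, mem_ofPred_eq, hint]

theorem IsLevyMeasureOf.blumenthalGetoor_eq (h : IsLevyMeasureOf P X η) :
    blumenthalGetoor P X = sInf (bgSet η) := by
  have hex : ∃ η, IsLevyMeasureOf P X η := ⟨η, h⟩
  have hl : IsLevyMeasureOf P X (levyMeasure P X) := by
    rw [levyMeasure, dif_pos hex]
    exact hex.choose_spec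
  rw [← hl.bgSet_eq h]
  rfl

end

/-! ### Lévy measures of subordinators and of Gaussian mixtures -/

section

variable {Ω : Type u} [MeasurableSpace Ω] {P : Measure Ω}

/-- The characteristic function is the Laplace transform on the imaginary axis. The truncation term
is integrable on its own and becomes the drift `b`. -/
theorem isLevyMeasureOf_of_laplace {X : ℝ≥0 → Ω → ℝ} {ν : Measure ℝ}
    (hν : IsSubordinatorMeasure ν) (h0 : ν {0} = 0)
    (h : ∀ u : ℂ, 0 ≤ u.re →
      ∫ ω, Complex.exp (-u * (X 1 ω : ℂ)) ∂P = Complex.exp (laplaceExponent ν u)) :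
    IsLevyMeasureOf P X ν := by
  refine ⟨h0, hν.lintegral_sq_lt_top, ∫ z, (Icc (-1 : ℝ) 1).indicator (fun z => z) z ∂ν, 0,
    fun u => ?_⟩
  have hre : 0 ≤ (-(Complex.I * (u : ℂ))).re := by simp
  have h1 := h _ hre
  rw [neg_neg] at h1
  rw [h1]
  have hL := hν.integrable_kernel hre
  have hK := integrable_levyKernel hν.lintegral_sq_lt_top u
  have hI := indicator_I_mul u
  -- The compensator is the difference of the Laplace and Lévy kernels, both already integrable.
  have hD : Integrable (fun z : ℝ => Complex.I * (u : ℂ) *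
      (((Icc (-1 : ℝ) 1).indicator (fun z => z) z : ℝ) : ℂ)) ν := by
    refine (hL.sub hK).congr (Eventually.of_forall fun z => ?_)
    simp only [Pi.sub_apply, hI, neg_neg]
    ring
  have hL' : Integrable (fun z : ℝ => Complex.exp (Complex.I * (u : ℂ) * (z : ℂ)) - 1) ν := by
    simpa using hL
  congr 1
  simp only [hI]
  rw [integral_sub hL' hD, integral_const_mul, integral_complex_ofReal, laplaceExponent]
  simp only [neg_neg, NNReal.coe_zero, Complex.ofReal_zero]
  ring

/-- The image of `ρ ⊗ N(0, 1)` under `(y, w) ↦ θ y + √y w`. -/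
noncomputable def mixtureMeasure (ρ : Measure ℝ) (θ : ℝ) : Measure ℝ :=
  (ρ.prod (gaussianReal 0 1)).map fun p => θ * p.1 + √p.1 * p.2

variable {ρ : Measure ℝ} {θ : ℝ}

/-! ### Truncated moments of the mixture measure -/

theorem lintegral_one_add_abs_rpow_gaussian_lt_top (θ p : ℝ) (hp : 0 < p) :
    ∫⁻ w, ENNReal.ofReal ((|θ| + |w| + 1) ^ p) ∂(gaussianReal 0 1) < ∞ := by
  have h1 : MemLp (fun w : ℝ => |θ| + |w| + 1) (ENNReal.ofReal p) (gaussianReal 0 1) := by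
    have hid : MemLp (fun w : ℝ => w) (ENNReal.ofReal p) (gaussianReal 0 1) :=
      memLp_id_gaussianReal' _ ENNReal.ofReal_ne_top
    have hc : MemLp (fun _ : ℝ => |θ| + 1) (ENNReal.ofReal p) (gaussianReal 0 1) :=
      memLp_const _
    refine (hc.add hid.norm).ae_eq (Eventually.of_forall fun w => ?_)
    simp only [Pi.add_apply, Real.norm_eq_abs]
    ring
  have h2 := h1.integrable_norm_rpow (by simpa using hp) ENNReal.ofReal_ne_top
  rw [ENNReal.toReal_ofReal hp.le] at h2
  have h3 := h2.2
  rw [hasFiniteIntegral_iff_ofReal (Eventually.of_forall fun w => by positivity)] at h3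
  refine lt_of_le_of_lt (le_of_eq (lintegral_congr fun w => ?_)) h3
  rw [Real.norm_of_nonneg (by positivity)]

theorem min_abs_mixture_le {θ y w : ℝ} (hy : 0 ≤ y) :
    min |θ * y + √y * w| 1 ≤ (|θ| + |w| + 1) * √(min y 1) := by
  rcases le_total y 1 with h | h
  · rw [min_eq_left h]
    refine (min_le_left _ _).trans ((abs_add_le _ _).trans ?_)
    have h1 : y ≤ √y := Real.le_sqrt_of_sq_le (by nlinarith)
    rw [abs_mul, abs_mul, abs_of_nonneg hy, abs_of_nonneg (Real.sqrt_nonneg y)]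
    nlinarith [abs_nonneg θ, abs_nonneg w, Real.sqrt_nonneg y,
      mul_le_mul_of_nonneg_left h1 (abs_nonneg θ)]
  · rw [min_eq_right h, Real.sqrt_one, mul_one]
    refine (min_le_right _ _).trans ?_
    linarith [abs_nonneg θ, abs_nonneg w]

/-- When `w` has the sign of `θ`, the cross term in `(θ y + √y w)²` is nonnegative, so the square is
at least `y w² ≥ y`. -/
theorem le_min_abs_mixture {θ y w : ℝ} (hy : 0 ≤ y) (hw : 1 ≤ |w|) (hθ : 0 ≤ θ * w) :
    √(min y 1) ≤ min |θ * y + √y * w| 1 := by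
  refine le_min ?_ (Real.sqrt_le_one.2 (min_le_right _ _))
  refine (Real.sqrt_le_sqrt (min_le_left y 1)).trans ?_
  have hs := Real.sqrt_nonneg y
  refine abs_le_of_sq_le_sq' ?_ (abs_nonneg _) |>.2
  rw [sq_abs]
  have hw2 : 1 ≤ w ^ 2 := (one_le_sq_iff_one_le_abs _).2 hw
  have hsy : √y ^ 2 = y := Real.sq_sqrt hy
  have h1 : 0 ≤ (θ * w) * (y * √y) := mul_nonneg hθ (mul_nonneg hy hs)
  have h2 : √y ^ 2 * 1 ≤ √y ^ 2 * w ^ 2 := mul_le_mul_of_nonneg_left hw2 (sq_nonneg _)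
  nlinarith [sq_nonneg (θ * y)]

theorem sqrt_rpow_eq {y : ℝ} (hy : 0 ≤ y) (p : ℝ) : √y ^ p = y ^ (p / 2) := by
  rw [Real.sqrt_eq_rpow, ← Real.rpow_mul hy]
  congr 1
  ring

theorem gaussianReal_pos_of_tail (θ : ℝ) :
    gaussianReal 0 1 {w : ℝ | 1 ≤ |w| ∧ 0 ≤ θ * w} ≠ 0 := by
  have hpos : ∀ s : Set ℝ, IsOpen s → s.Nonempty → gaussianReal 0 1 s ≠ 0 := fun s hs hne h => by
    have := gaussianReal_absolutelyContinuous' 0 (one_ne_zero (α := ℝ≥0)) h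
    exact hs.measure_ne_zero volume hne this
  rcases le_total 0 θ with h | h
  · refine fun h0 => hpos (Ioi 1) isOpen_Ioi ⟨2, by simp⟩ (measure_mono_null ?_ h0)
    intro w hw
    have hw1 : (1 : ℝ) < w := hw
    exact ⟨hw1.le.trans (le_abs_self _), mul_nonneg h (by linarith)⟩
  · refine fun h0 => hpos (Iio (-1)) isOpen_Iio ⟨-2, by simp⟩ (measure_mono_null ?_ h0)
    intro w hw
    have hw1 : w < -1 := hw
    refine ⟨?_, mul_nonneg_of_nonpos_of_nonpos h (by linarith)⟩
    exact le_trans (by linarith) (neg_le_abs w)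

/-- The truncated jump is at most `(|θ| + |w| + 1) √(min y 1)`, where the first factor has all
Gaussian moments, and at least `√(min y 1)` on a set of `w` of positive Gaussian measure. The square
root halves the exponent. -/
theorem lintegral_mixtureMeasure_lt_top_iff [SFinite ρ] (hρ : IsSubordinatorMeasure ρ) {p : ℝ}
    (hp : 0 < p) : ∫⁻ z, ENNReal.ofReal ((min |z| 1) ^ p) ∂(mixtureMeasure ρ θ) < ∞ ↔
      ∫⁻ z, ENNReal.ofReal ((min |z| 1) ^ (p / 2)) ∂ρ < ∞ := by
  have hae : ∀ᵐ x ∂(ρ.prod (gaussianReal 0 1)), 0 ≤ x.1 :=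
    Measure.quasiMeasurePreserving_fst.ae hρ.ae_nonneg
  rw [mixtureMeasure, lintegral_map (by fun_prop) (by fun_prop)]
  constructor
  · intro h
    set A := {w : ℝ | 1 ≤ |w| ∧ 0 ≤ θ * w}
    have hA : MeasurableSet A := by
      have h1 : Measurable fun w : ℝ => |w| := by fun_prop
      have h2 : Measurable fun w : ℝ => θ * w := by fun_prop
      exact (measurableSet_le measurable_const h1).inter (measurableSet_le measurable_const h2)
    have h1 : (∫⁻ z, ENNReal.ofReal ((min |z| 1) ^ (p / 2)) ∂ρ) *
        ∫⁻ w, A.indicator 1 w ∂(gaussianReal 0 1) < ∞ := by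
      rw [← lintegral_prod_mul (by fun_prop) ((measurable_one.indicator hA).aemeasurable)]
      refine lt_of_le_of_lt (lintegral_mono_ae ?_) h
      filter_upwards [hae] with x hx
      by_cases hs : x.2 ∈ A
      · rw [indicator_of_mem hs, Pi.one_apply, mul_one, abs_of_nonneg hx,
          ← sqrt_rpow_eq (le_min hx zero_le_one)]
        exact ENNReal.ofReal_le_ofReal
          (Real.rpow_le_rpow (Real.sqrt_nonneg _) (le_min_abs_mixture hx hs.1 hs.2) hp.le)
      · simp [indicator_of_notMem hs]
    rw [lintegral_indicator_one hA] at h1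
    by_contra htop
    rw [not_lt_top_iff] at htop
    rw [htop, ENNReal.top_mul (gaussianReal_pos_of_tail θ)] at h1
    exact lt_irrefl _ h1
  · intro h
    calc ∫⁻ a, ENNReal.ofReal ((min |θ * a.1 + √a.1 * a.2| 1) ^ p) ∂(ρ.prod (gaussianReal 0 1))
        ≤ ∫⁻ a, ENNReal.ofReal ((min |a.1| 1) ^ (p / 2)) *
            ENNReal.ofReal ((|θ| + |a.2| + 1) ^ p) ∂(ρ.prod (gaussianReal 0 1)) := by
          refine lintegral_mono_ae ?_
          filter_upwards [hae] with x hx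
          rw [abs_of_nonneg hx, ← sqrt_rpow_eq (le_min hx zero_le_one),
            mul_comm (ENNReal.ofReal _),
            ← ENNReal.ofReal_mul (by positivity),
            ← Real.mul_rpow (by positivity) (Real.sqrt_nonneg _)]
          refine ENNReal.ofReal_le_ofReal (Real.rpow_le_rpow ?_ (min_abs_mixture_le hx) hp.le)
          exact le_min (abs_nonneg _) zero_le_one
      _ = (∫⁻ z, ENNReal.ofReal ((min |z| 1) ^ (p / 2)) ∂ρ) *
            ∫⁻ w, ENNReal.ofReal ((|θ| + |w| + 1) ^ p) ∂(gaussianReal 0 1) :=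
          lintegral_prod_mul (f := fun z => ENNReal.ofReal ((min |z| 1) ^ (p / 2)))
            (g := fun w => ENNReal.ofReal ((|θ| + |w| + 1) ^ p)) (by fun_prop) (by fun_prop)
      _ < ∞ := ENNReal.mul_lt_top h (lintegral_one_add_abs_rpow_gaussian_lt_top θ p hp)

theorem lintegral_sq_mixtureMeasure_lt_top [SFinite ρ] (hρ : IsSubordinatorMeasure ρ) :
    ∫⁻ z, ENNReal.ofReal (min (z ^ 2) 1) ∂(mixtureMeasure ρ θ) < ∞ := by
  -- The exponent `2` on the mixture side is the exponent `1` on the clock side, which is the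
  -- integrability of `min z 1`.
  have h := (lintegral_mixtureMeasure_lt_top_iff (θ := θ) hρ two_pos).2 (by
    refine lt_of_le_of_lt (lintegral_mono_ae ?_) hρ.lintegral_lt_top
    filter_upwards [hρ.ae_nonneg] with z hz
    rw [abs_of_nonneg hz]
    norm_num)
  refine lt_of_le_of_lt (lintegral_mono fun z => ENNReal.ofReal_le_ofReal ?_) h
  rw [Real.rpow_two]
  rcases le_total |z| 1 with hz | hz
  · rw [min_eq_left hz, sq_abs]
    exact min_le_left _ _
  · rw [min_eq_right hz, one_pow]
    exact min_le_right _ _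

theorem bgSet_mixtureMeasure [SFinite ρ] (hρ : IsSubordinatorMeasure ρ) (p : ℝ) :
    p ∈ bgSet ((mixtureMeasure ρ θ).restrict {0}ᶜ) ↔ p / 2 ∈ bgSet ρ := by
  have hsq : ∫⁻ z, ENNReal.ofReal (min (z ^ 2) 1) ∂((mixtureMeasure ρ θ).restrict {0}ᶜ) < ∞ :=
    (lintegral_mono' Measure.restrict_le_self le_rfl).trans_lt
      (lintegral_sq_mixtureMeasure_lt_top hρ)
  rw [mem_bgSet_iff hsq, mem_bgSet_iff hρ.lintegral_sq_lt_top]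
  constructor
  · rintro ⟨hp, h⟩
    refine ⟨by positivity, (lintegral_mixtureMeasure_lt_top_iff (θ := θ) hρ hp).1 ?_⟩
    -- `ρ` may charge `0`, for instance where a scaling kernel vanishes. That part contributes
    -- nothing because `0 ^ p = 0`.
    rw [← lintegral_add_compl _ (measurableSet_singleton (0 : ℝ)), lintegral_singleton]
    simpa [Real.zero_rpow hp.ne'] using h
  · rintro ⟨hp, h⟩
    have hp' : 0 < p := by linarith
    exact ⟨hp', (lintegral_mono' Measure.restrict_le_self le_rfl).trans_lt
      ((lintegral_mixtureMeasure_lt_top_iff (θ := θ) hρ hp').2 h)⟩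

open scoped Pointwise in
theorem sInf_bgSet_mixtureMeasure [SFinite ρ] (hρ : IsSubordinatorMeasure ρ) :
    sInf (bgSet ((mixtureMeasure ρ θ).restrict {0}ᶜ)) = 2 * sInf (bgSet ρ) := by
  have : bgSet ((mixtureMeasure ρ θ).restrict {0}ᶜ) = (2 : ℝ) • bgSet ρ := by
    ext p
    rw [bgSet_mixtureMeasure hρ, Set.mem_smul_set_iff_inv_smul_mem₀ two_ne_zero, smul_eq_mul]
    ring_nf
  rw [this, Real.sInf_smul_of_nonneg zero_le_two, smul_eq_mul]

/-! ### Lévy–Khintchine form of the mixture -/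

theorem integral_exp_gaussian (u a s : ℝ) :
    ∫ w, Complex.exp (Complex.I * (u : ℂ) * ((a + s * w : ℝ) : ℂ)) ∂(gaussianReal 0 1) =
      Complex.exp (Complex.I * u * a - (u * s) ^ 2 / 2) := by
  have h := charFun_gaussianReal (μ := 0) (v := 1) (u * s)
  rw [charFun_apply_real] at h
  rw [sub_eq_add_neg, Complex.exp_add]
  have h' : -((u : ℂ) * s) ^ 2 / 2 = -(((u : ℂ) * s) ^ 2 / 2) := by ring
  simp only [Complex.ofReal_mul, Complex.ofReal_zero, mul_zero, zero_mul, NNReal.coe_one,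
    Complex.ofReal_one, one_mul, zero_sub] at h
  rw [← h, ← integral_const_mul]
  refine integral_congr_ae (Eventually.of_forall fun w => ?_)
  simp only
  rw [← Complex.exp_add]
  congr 1
  push_cast
  ring

/-- The mean of the truncation to `[-1, 1]` of a Gaussian variable of mean `θ y` and
variance `y`. -/
noncomputable def truncatedMean (θ y : ℝ) : ℝ :=
  ∫ w, (Icc (-1 : ℝ) 1).indicator (fun z => z) (θ * y + √y * w) ∂(gaussianReal 0 1)

/-- Integrating out `w` turns the Lévy kernel at `u` into the Laplace kernel at `u² / 2 - i u θ`, up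
to the mean of the truncation. -/
theorem integral_levyKernel_gaussian (u θ : ℝ) {y : ℝ} (hy : 0 ≤ y) :
    ∫ w, (Complex.exp (Complex.I * (u : ℂ) * ((θ * y + √y * w : ℝ) : ℂ)) - 1 -
      (Icc (-1 : ℝ) 1).indicator (fun z : ℝ => Complex.I * (u : ℂ) * (z : ℂ)) (θ * y + √y * w))
        ∂(gaussianReal 0 1) =
      (Complex.exp (-((u : ℂ) ^ 2 / 2 - Complex.I * u * θ) * y) - 1) -
        Complex.I * u * (truncatedMean θ y : ℂ) := by
  have hI := indicator_I_mul u
  have hm : Measurable ((Icc (-1 : ℝ) 1).indicator (fun z : ℝ => z)) :=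
    Measurable.indicator measurable_id measurableSet_Icc
  have hi1 : Integrable (fun w : ℝ => Complex.exp (Complex.I * (u : ℂ) *
      ((θ * y + √y * w : ℝ) : ℂ))) (gaussianReal 0 1) := by
    refine (integrable_const (1 : ℝ)).mono' (by fun_prop) (Eventually.of_forall fun w => ?_)
    rw [mul_assoc, ← Complex.ofReal_mul, mul_comm, Complex.norm_exp_ofReal_mul_I]
  have hi2 : Integrable (fun w : ℝ => Complex.I * (u : ℂ) *
      (((Icc (-1 : ℝ) 1).indicator (fun z => z) (θ * y + √y * w) : ℝ) : ℂ)) (gaussianReal 0 1) := by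
    refine Integrable.const_mul (Integrable.ofReal ?_) _
    refine (integrable_const (1 : ℝ)).mono' ?_ (Eventually.of_forall fun w => ?_)
    · exact (hm.comp (by fun_prop : Measurable fun w : ℝ => θ * y + √y * w)).aestronglyMeasurable
    · change ‖(Icc (-1 : ℝ) 1).indicator (fun z => z) (θ * y + √y * w)‖ ≤ 1
      by_cases hz : θ * y + √y * w ∈ Icc (-1 : ℝ) 1
      · rw [indicator_of_mem hz]
        exact abs_le.2 hz
      · rw [indicator_of_notMem hz, norm_zero]
        exact zero_le_one
  simp only [hI]
  have hi3 : Integrable (fun w : ℝ => Complex.exp (Complex.I * (u : ℂ) *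
      ((θ * y + √y * w : ℝ) : ℂ)) - 1) (gaussianReal 0 1) := hi1.sub (integrable_const 1)
  rw [integral_sub hi3 hi2, integral_sub hi1 (integrable_const 1),
    integral_exp_gaussian, integral_const_mul, integral_complex_ofReal, truncatedMean]
  simp only [integral_const, probReal_univ, one_smul]
  congr 3
  have hs : ((√y : ℝ) : ℂ) ^ 2 = (y : ℂ) := by
    rw [← Complex.ofReal_pow, Real.sq_sqrt hy]
  rw [mul_pow, hs]
  push_cast
  ring

/-- Fubini on `ρ ⊗ N(0, 1)` identifies the two exponents; the integrated truncated means join `μ` in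
the drift, and there is no Gaussian part. -/
theorem isLevyMeasureOf_mixture [SFinite ρ] (hρ : IsSubordinatorMeasure ρ) {Z : ℝ≥0 → Ω → ℝ}
    (μ θ : ℝ)
    (h : ∀ u : ℝ, ∫ ω, Complex.exp (Complex.I * (u : ℂ) * (Z 1 ω : ℂ)) ∂P =
      Complex.exp (Complex.I * u * μ) *
        Complex.exp (laplaceExponent ρ ((u : ℂ) ^ 2 / 2 - Complex.I * u * θ))) :
    IsLevyMeasureOf P Z ((mixtureMeasure ρ θ).restrict {0}ᶜ) := by
  have hsq := lintegral_sq_mixtureMeasure_lt_top (θ := θ) hρ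
  refine ⟨by simp, (lintegral_mono' Measure.restrict_le_self le_rfl).trans_lt hsq,
    μ + ∫ y, truncatedMean θ y ∂ρ, 0, fun u => ?_⟩
  rw [h, ← Complex.exp_add]
  congr 1
  have hmap : Measurable fun p : ℝ × ℝ => θ * p.1 + √p.1 * p.2 := by fun_prop
  have hK := integrable_levyKernel hsq u
  have hm := (measurable_levyKernel u).aestronglyMeasurable (μ := mixtureMeasure ρ θ)
  have hre : 0 ≤ ((u : ℂ) ^ 2 / 2 - Complex.I * u * θ).re := by
    have : (u : ℂ) ^ 2 / 2 - Complex.I * u * θ =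
        ((u ^ 2 / 2 : ℝ) : ℂ) - Complex.I * ((u * θ : ℝ) : ℂ) := by push_cast; ring
    rw [this]
    simp only [Complex.sub_re, Complex.ofReal_re, Complex.I_mul_re, Complex.ofReal_im]
    nlinarith [sq_nonneg u]
  -- The Lévy kernel vanishes at `0`, so removing that point does not change the integral.
  rw [setIntegral_eq_integral_of_forall_compl_eq_zero]
  swap
  · intro z hz
    have : z = 0 := by simpa using hz
    simp [this]
  rw [mixtureMeasure] at hK hm ⊢
  rw [integral_map hmap.aemeasurable hm]
  rw [integrable_map_measure hm hmap.aemeasurable] at hK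
  have hL := hρ.integrable_kernel hre
  have hKint := hK.integral_prod_left
  have hae : ∀ᵐ y ∂ρ, (∫ w, (Complex.exp (Complex.I * (u : ℂ) * ((θ * y + √y * w : ℝ) : ℂ)) - 1 -
      (Icc (-1 : ℝ) 1).indicator (fun z : ℝ => Complex.I * (u : ℂ) * (z : ℂ)) (θ * y + √y * w))
        ∂(gaussianReal 0 1)) =
      (Complex.exp (-((u : ℂ) ^ 2 / 2 - Complex.I * u * θ) * y) - 1) -
        Complex.I * u * (truncatedMean θ y : ℂ) := by
    filter_upwards [hρ.ae_nonneg] with y hy using integral_levyKernel_gaussian u θ hy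
  -- Integrability of the truncated means is again obtained as a difference of integrable functions,
  -- with no estimate on them.
  have hT : Integrable (fun y => Complex.I * u * (truncatedMean θ y : ℂ)) ρ := by
    refine (hL.sub hKint).congr ?_
    filter_upwards [hae] with y hy
    simp only [Pi.sub_apply, Function.comp_apply]
    rw [hy]
    ring
  have hprod := (integral_prod _ hK).trans (integral_congr_ae hae)
  simp only [Function.comp_apply] at hprod
  rw [hprod, integral_sub hL hT, integral_const_mul, integral_complex_ofReal, laplaceExponent]
  push_cast
  ring

end

/-! ### Uniform grids -/

/-- The smallest multiple of `1 / (N + 1)` in `[0, ∞)` that is at least `s`. -/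
noncomputable def gridCeil (N : ℕ) (s : ℝ) : ℝ≥0 := (⌈s * ((N : ℝ) + 1)⌉₊ : ℝ≥0) / ((N : ℝ≥0) + 1)

theorem coe_gridCeil (N : ℕ) (s : ℝ) :
    (gridCeil N s : ℝ) = (⌈s * ((N : ℝ) + 1)⌉₊ : ℝ) / ((N : ℝ) + 1) := by
  simp [gridCeil]

theorem tendsto_gridCeil {s : ℝ} (hs : 0 ≤ s) :
    Tendsto (fun N => gridCeil N s) atTop (𝓝 s.toNNReal) := by
  rw [← NNReal.tendsto_coe, Real.coe_toNNReal s hs]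
  simp only [coe_gridCeil]
  have h1 : Tendsto (fun N : ℕ => (N : ℝ) + 1) atTop atTop :=
    tendsto_atTop_add_const_right _ _ tendsto_natCast_atTop_atTop
  exact (tendsto_nat_ceil_mul_div_atTop hs).comp h1

theorem le_gridCeil (N : ℕ) (s : ℝ) : s.toNNReal ≤ gridCeil N s := by
  rw [Real.toNNReal_le_iff_le_coe, coe_gridCeil, le_div_iff₀ (by positivity)]
  exact Nat.le_ceil _

theorem gridCeil_le_one (N : ℕ) {s : ℝ} (hs : s ≤ 1) : gridCeil N s ≤ 1 := by
  rw [← NNReal.coe_le_coe, coe_gridCeil, NNReal.coe_one, div_le_one (by positivity)]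
  have : ⌈s * ((N : ℝ) + 1)⌉₊ ≤ N + 1 := by
    rw [Nat.ceil_le]
    push_cast
    have : (0 : ℝ) ≤ N := Nat.cast_nonneg N
    nlinarith
  exact_mod_cast this

theorem measurable_gridCeil (N : ℕ) : Measurable fun s => gridCeil N s := by
  unfold gridCeil
  have : Measurable fun s : ℝ => ⌈s * ((N : ℝ) + 1)⌉₊ := Nat.measurable_ceil.comp (by fun_prop)
  fun_prop

/-- Evaluation of an arbitrary path at a variable time is not jointly measurable for the product
σ-algebra; rounding to a grid leaves countably many coordinates, for which it is. -/
theorem measurable_eval_gridCeil (N : ℕ) :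
    Measurable fun p : ℝ × (ℝ≥0 → ℝ) => p.2 (gridCeil N p.1) := by
  have h : Measurable fun p : ℕ × (ℝ≥0 → ℝ) => p.2 ((p.1 : ℝ≥0) / ((N : ℝ≥0) + 1)) :=
    measurable_from_prod_countable_right fun n =>
      measurable_pi_apply ((n : ℝ≥0) / ((N : ℝ≥0) + 1))
  have h2 : Measurable fun p : ℝ × (ℝ≥0 → ℝ) => (⌈p.1 * ((N : ℝ) + 1)⌉₊, p.2) :=
    (Nat.measurable_ceil.comp (by fun_prop)).prodMk measurable_snd
  exact h.comp h2

/-! ### Brownian motion evaluated at an independent time -/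

section

variable {Ω : Type u} [MeasurableSpace Ω] {P : Measure Ω}

theorem integral_exp_brownian {W : ℝ≥0 → Ω → ℝ} (hW : IsBrownianReal W P) (u : ℝ) (t : ℝ≥0) :
    ∫ ω, Complex.exp (Complex.I * u * (W t ω : ℂ)) ∂P = Complex.exp (-((u : ℂ) ^ 2 / 2) * t) := by
  have hlaw := hW.hasLaw_eval t
  have h := charFun_gaussianReal (μ := 0) (v := t) u
  rw [← hlaw.map_eq, charFun_apply_real, integral_map hlaw.aemeasurable (by fun_prop)] at h
  have h2 : ∫ ω, Complex.exp (Complex.I * u * (W t ω : ℂ)) ∂P =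
      ∫ ω, Complex.exp (u * (W t ω : ℂ) * Complex.I) ∂P := by
    congr 1; ext ω; congr 1; ring
  rw [h2, h]
  congr 1
  push_cast
  ring

/-- By independence the law of `V 1` and the whole path of `W` is a product, so the path can be
integrated out with the time frozen. -/
theorem integral_exp_brownian_grid [IsProbabilityMeasure P] {V W : ℝ≥0 → Ω → ℝ}
    (hW : IsIndepBrownian P V W) (hV : Measurable (V 1)) (θ u : ℝ) (N : ℕ) :
    ∫ ω, Complex.exp (Complex.I * u * ((θ * V 1 ω + W (gridCeil N (V 1 ω)) ω : ℝ) : ℂ)) ∂P =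
      ∫ ω, Complex.exp (Complex.I * u * (θ * V 1 ω) -
        (u : ℂ) ^ 2 / 2 * (gridCeil N (V 1 ω) : ℝ)) ∂P := by
  have hWm : Measurable fun ω t => W t ω := measurable_pi_lambda _ hW.measurable
  have hind : IndepFun (V 1) (fun ω t => W t ω) P :=
    hW.indep.comp (measurable_pi_apply (1 : ℝ≥0)) measurable_id
  have hprod := hind.map_prod_eq_prod_map_map hV.aemeasurable hWm.aemeasurable
  set F : ℝ × (ℝ≥0 → ℝ) → ℂ := fun p =>
    Complex.exp (Complex.I * u * ((θ * p.1 + p.2 (gridCeil N p.1) : ℝ) : ℂ)) with hF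
  have hFm : Measurable F := by
    have := measurable_eval_gridCeil N
    fun_prop
  have hpV : IsProbabilityMeasure (P.map (V 1)) := Measure.isProbabilityMeasure_map hV.aemeasurable
  have hpW : IsProbabilityMeasure (P.map fun ω t => W t ω) :=
    Measure.isProbabilityMeasure_map hWm.aemeasurable
  have hFi : Integrable F ((P.map (V 1)).prod (P.map fun ω t => W t ω)) := by
    refine (integrable_const (1 : ℝ)).mono' hFm.aestronglyMeasurable
      (Eventually.of_forall fun w => ?_)
    rw [hF]
    simp only
    rw [mul_assoc, ← Complex.ofReal_mul, mul_comm, Complex.norm_exp_ofReal_mul_I]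
  have hinner : ∀ v : ℝ, ∫ w, F (v, w) ∂(P.map fun ω t => W t ω) =
      Complex.exp (Complex.I * u * (θ * v) - (u : ℂ) ^ 2 / 2 * (gridCeil N v : ℝ)) := fun v => by
    have hFv : AEStronglyMeasurable (fun w => F (v, w)) (P.map fun ω t => W t ω) :=
      (hFm.comp measurable_prodMk_left).aestronglyMeasurable
    rw [integral_map hWm.aemeasurable hFv, sub_eq_add_neg, Complex.exp_add, ← neg_mul]
    have hb := integral_exp_brownian hW.brownian u (gridCeil N v)
    rw [← hb, ← integral_const_mul]
    refine integral_congr_ae (Eventually.of_forall fun ω => ?_)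
    simp only [hF]
    rw [← Complex.exp_add]
    congr 1
    push_cast
    ring
  have hgm := measurable_gridCeil N
  calc _ = ∫ ω, F (V 1 ω, fun t => W t ω) ∂P := rfl
    _ = ∫ p, F p ∂(P.map fun ω => (V 1 ω, fun t => W t ω)) := by
        rw [integral_map (hV.prodMk hWm).aemeasurable hFm.aestronglyMeasurable]
    _ = ∫ v, ∫ w, F (v, w) ∂(P.map fun ω t => W t ω) ∂(P.map (V 1)) := by
        rw [hprod, integral_prod _ hFi]
    _ = _ := by
        simp only [hinner]
        rw [integral_map hV.aemeasurable]
        fun_prop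

/-- Refine the grid: continuity of Brownian paths gives the limit on one side, convergence of the
rounded times gives it on the other, and all integrands have modulus at most `1`. -/
theorem integral_exp_gaussianMixture [IsProbabilityMeasure P] {V W : ℝ≥0 → Ω → ℝ}
    (hW : IsIndepBrownian P V W) (hV : Measurable (V 1)) (hV0 : ∀ᵐ ω ∂P, 0 ≤ V 1 ω) (μ θ u : ℝ) :
    ∫ ω, Complex.exp (Complex.I * (u : ℂ) * (gaussianMixture μ θ V W 1 ω : ℂ)) ∂P =
      Complex.exp (Complex.I * u * μ) *
        ∫ ω, Complex.exp (-((u : ℂ) ^ 2 / 2 - Complex.I * u * θ) * (V 1 ω : ℂ)) ∂P := by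
  have h1 : ∫ ω, Complex.exp (Complex.I * (u : ℂ) * (gaussianMixture μ θ V W 1 ω : ℂ)) ∂P =
      Complex.exp (Complex.I * u * μ) * ∫ ω, Complex.exp (Complex.I * u *
        ((θ * V 1 ω + W (V 1 ω).toNNReal ω : ℝ) : ℂ)) ∂P := by
    rw [← integral_const_mul]
    refine integral_congr_ae (Eventually.of_forall fun ω => ?_)
    simp only [gaussianMixture]
    rw [← Complex.exp_add]
    congr 1
    push_cast
    ring
  rw [h1]
  congr 1
  have hgm := measurable_gridCeil
  have hWm : Measurable fun ω t => W t ω := measurable_pi_lambda _ hW.measurable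
  have hl : Tendsto (fun N => ∫ ω, Complex.exp (Complex.I * u *
      ((θ * V 1 ω + W (gridCeil N (V 1 ω)) ω : ℝ) : ℂ)) ∂P) atTop
      (𝓝 (∫ ω, Complex.exp (Complex.I * u *
        ((θ * V 1 ω + W (V 1 ω).toNNReal ω : ℝ) : ℂ)) ∂P)) := by
    refine tendsto_integral_of_dominated_convergence (fun _ => 1) (fun N => ?_)
      (integrable_const _) (fun N => Eventually.of_forall fun ω => ?_) ?_
    · have h2 : Measurable fun ω => W (gridCeil N (V 1 ω)) ω :=
        (measurable_eval_gridCeil N).comp (hV.prodMk hWm)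
      have h3 : Continuous fun x : ℝ => Complex.exp (Complex.I * u * (x : ℂ)) := by fun_prop
      exact (h3.measurable.comp ((hV.const_mul θ).add h2)).aestronglyMeasurable
    · rw [mul_assoc, ← Complex.ofReal_mul, mul_comm, Complex.norm_exp_ofReal_mul_I]
    · filter_upwards [hV0, hW.brownian.cont] with ω h0 hc
      have h2 : Tendsto (fun N => W (gridCeil N (V 1 ω)) ω) atTop (𝓝 (W (V 1 ω).toNNReal ω)) :=
        (hc.tendsto _).comp (tendsto_gridCeil h0)
      have h3 : Continuous fun x : ℝ => Complex.exp (Complex.I * u * ((θ * V 1 ω + x : ℝ) : ℂ)) := by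
        fun_prop
      exact (h3.tendsto _).comp h2
  have hr : Tendsto (fun N => ∫ ω, Complex.exp (Complex.I * u * (θ * V 1 ω) -
      (u : ℂ) ^ 2 / 2 * (gridCeil N (V 1 ω) : ℝ)) ∂P) atTop
      (𝓝 (∫ ω, Complex.exp (-((u : ℂ) ^ 2 / 2 - Complex.I * u * θ) * (V 1 ω : ℂ)) ∂P)) := by
    refine tendsto_integral_of_dominated_convergence (fun _ => 1) (fun N => ?_)
      (integrable_const _) (fun N => Eventually.of_forall fun ω => ?_) ?_
    · have := hgm N
      exact Measurable.aestronglyMeasurable (by fun_prop)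
    · rw [Complex.norm_exp, Real.exp_le_one_iff,
        show Complex.I * u * (θ * V 1 ω) - (u : ℂ) ^ 2 / 2 * (gridCeil N (V 1 ω) : ℝ) =
          Complex.I * ((u * (θ * V 1 ω) : ℝ) : ℂ) - ((u ^ 2 / 2 * gridCeil N (V 1 ω) : ℝ) : ℂ) by
          push_cast; ring]
      simp only [Complex.sub_re, Complex.I_mul_re, Complex.ofReal_im, Complex.ofReal_re, neg_zero,
        zero_sub, Left.neg_nonpos_iff]
      positivity
    · filter_upwards [hV0] with ω h0
      have h2 : Tendsto (fun N => (gridCeil N (V 1 ω) : ℝ)) atTop (𝓝 (V 1 ω)) := by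
        have := NNReal.tendsto_coe.2 (tendsto_gridCeil h0)
        rwa [Real.coe_toNNReal _ h0] at this
      have h3 : Continuous fun x : ℝ => Complex.exp (Complex.I * u * (θ * V 1 ω) -
        (u : ℂ) ^ 2 / 2 * (x : ℝ)) := by fun_prop
      have h4 := (h3.tendsto _).comp h2
      rw [show -((u : ℂ) ^ 2 / 2 - Complex.I * u * θ) * (V 1 ω : ℂ) =
        Complex.I * u * (θ * V 1 ω) - (u : ℂ) ^ 2 / 2 * (V 1 ω : ℝ) by ring]
      exact h4
  refine tendsto_nhds_unique hl (hr.congr fun N => ?_)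
  exact (integral_exp_brownian_grid hW hV θ u N).symm

/-- A Gaussian mixture over a clock with Lévy measure `ρ` has a Lévy measure, and its
Blumenthal–Getoor index is twice that of `ρ`. -/
theorem blumenthalGetoor_gaussianMixture [IsProbabilityMeasure P] {V W : ℝ≥0 → Ω → ℝ}
    (hW : IsIndepBrownian P V W) (hV : Measurable (V 1)) (hV0 : ∀ᵐ ω ∂P, 0 ≤ V 1 ω)
    {ρ : Measure ℝ} [SFinite ρ] (hρ : IsSubordinatorMeasure ρ)
    (hL : ∀ u : ℂ, 0 ≤ u.re →
      ∫ ω, Complex.exp (-u * (V 1 ω : ℂ)) ∂P = Complex.exp (laplaceExponent ρ u)) (μ θ : ℝ) :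
    (∃ η, IsLevyMeasureOf P (gaussianMixture μ θ V W) η) ∧
      blumenthalGetoor P (gaussianMixture μ θ V W) = 2 * sInf (bgSet ρ) := by
  have h : IsLevyMeasureOf P (gaussianMixture μ θ V W) ((mixtureMeasure ρ θ).restrict {0}ᶜ) := by
    refine isLevyMeasureOf_mixture hρ μ θ fun u => ?_
    rw [integral_exp_gaussianMixture hW hV hV0, hL]
    rw [show (u : ℂ) ^ 2 / 2 - Complex.I * u * θ =
        ((u ^ 2 / 2 : ℝ) : ℂ) - Complex.I * ((u * θ : ℝ) : ℂ) by push_cast; ring]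
    simp only [Complex.sub_re, Complex.ofReal_re, Complex.I_mul_re, Complex.ofReal_im]
    nlinarith [sq_nonneg u]
  exact ⟨⟨_, h⟩, by rw [h.blumenthalGetoor_eq, sInf_bgSet_mixtureMeasure hρ]⟩

end

/-! ### Laplace transforms of integrals of a subordinator -/

section

variable {Ω : Type u} [MeasurableSpace Ω] {P : Measure Ω} {X : ℝ≥0 → Ω → ℝ} {ρ : Measure ℝ}

theorem IsSubordinator.ae_nonneg (hX : IsSubordinator P X) : ∀ᵐ ω ∂P, ∀ t, 0 ≤ X t ω := by
  filter_upwards [hX.monotone, hX.zero] with ω hm h0 t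
  rw [← h0]
  exact hm (zero_le (a := t))

theorem norm_exp_neg_mul_le_one {u : ℂ} (hu : 0 ≤ u.re) {x : ℝ} (hx : 0 ≤ x) :
    ‖Complex.exp (-u * x)‖ ≤ 1 := by
  rw [Complex.norm_exp, Real.exp_le_one_iff]
  simpa using mul_nonneg hu hx

theorem integral_exp_sum_increments (hX : IsSubordinator P X) (N : ℕ) (c : ℕ → ℂ) :
    ∫ ω, Complex.exp (∑ j ∈ Finset.range (N + 1), -c j *
      ((X (((j + 1 : ℕ) : ℝ≥0) / (N + 1)) ω - X ((j : ℝ≥0) / (N + 1)) ω : ℝ) : ℂ)) ∂P =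
      ∏ j ∈ Finset.range (N + 1), ∫ ω, Complex.exp (-c j * (X (1 / (N + 1)) ω : ℂ)) ∂P := by
  have hmono : Monotone fun j : ℕ => (j : ℝ≥0) / ((N : ℝ≥0) + 1) := fun i j hij => by
    have : (i : ℝ≥0) ≤ j := by exact_mod_cast hij
    simp only
    gcongr
  have hind : iIndepFun (fun (j : Fin (N + 1)) ω =>
      X (((j.val + 1 : ℕ) : ℝ≥0) / (N + 1)) ω - X ((j.val : ℝ≥0) / (N + 1)) ω) P :=
    (hX.indepIncrements.nat hmono).precomp Fin.val_injective
  have hmeas : ∀ j : ℕ, Measurable fun ω =>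
      X (((j + 1 : ℕ) : ℝ≥0) / (N + 1)) ω - X ((j : ℝ≥0) / (N + 1)) ω :=
    fun j => (hX.measurable _).sub (hX.measurable _)
  have h := hind.integral_fun_prod_comp (𝕜 := ℂ)
    (f := fun (j : Fin (N + 1)) (x : ℝ) => Complex.exp (-c j.val * (x : ℂ)))
    (fun j => (hmeas j.val).aemeasurable) (fun j => by fun_prop)
  rw [Fin.prod_univ_eq_prod_range (fun j => ∫ ω, Complex.exp (-c j *
      ((X (((j + 1 : ℕ) : ℝ≥0) / (N + 1)) ω - X ((j : ℝ≥0) / (N + 1)) ω : ℝ) : ℂ)) ∂P) (N + 1)] at h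
  have h2 : ∀ j : ℕ, ∫ ω, Complex.exp (-c j *
      ((X (((j + 1 : ℕ) : ℝ≥0) / (N + 1)) ω - X ((j : ℝ≥0) / (N + 1)) ω : ℝ) : ℂ)) ∂P =
      ∫ ω, Complex.exp (-c j * (X (1 / (N + 1)) ω : ℂ)) ∂P := fun j => by
    have hs := hX.stationaryIncrements ((j : ℝ≥0) / (N + 1)) (1 / (N + 1))
    have hadd : (j : ℝ≥0) / (N + 1) + 1 / (N + 1) = ((j + 1 : ℕ) : ℝ≥0) / (N + 1) := by
      rw [← add_div]; push_cast; rfl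
    rw [hadd] at hs
    exact (hs.comp (u := fun x : ℝ => Complex.exp (-c j * (x : ℂ))) (by fun_prop)).integral_eq
  simp only [h2] at h
  rw [← h]
  congr 1
  ext ω
  rw [Complex.exp_sum, Fin.prod_univ_eq_prod_range (fun j => Complex.exp (-c j *
    ((X (((j + 1 : ℕ) : ℝ≥0) / (N + 1)) ω - X ((j : ℝ≥0) / (N + 1)) ω : ℝ) : ℂ))) (N + 1)]

theorem continuousOn_integral_exp (hX : IsSubordinator P X) (t : ℝ≥0) :
    ContinuousOn (fun u : ℂ => ∫ ω, Complex.exp (-u * (X t ω : ℂ)) ∂P) {u | 0 ≤ u.re} := by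
  have := hX.isProbabilityMeasure
  have hm := hX.measurable t
  intro u hu
  refine tendsto_integral_filter_of_dominated_convergence (fun _ => 1) ?_ ?_
    (integrable_const _) ?_
  · exact Eventually.of_forall fun w => Measurable.aestronglyMeasurable (by fun_prop)
  · filter_upwards [self_mem_nhdsWithin] with w hw
    filter_upwards [hX.ae_nonneg] with ω h0 using norm_exp_neg_mul_le_one hw (h0 t)
  · refine Eventually.of_forall fun ω => ?_
    have : Continuous fun w : ℂ => Complex.exp (-w * (X t ω : ℂ)) := by fun_prop
    exact this.continuousAt.tendsto.mono_left nhdsWithin_le_nhds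

/-- The image of the interval is connected and lies in the finite set of `n`-th roots of unity,
hence is a point. -/
theorem eq_one_of_continuousOn_pow_eq_one {g : ℝ → ℂ} {n : ℕ} (hn : n ≠ 0)
    (hg : ContinuousOn g (Icc 0 1)) (h : ∀ x ∈ Icc (0 : ℝ) 1, g x ^ n = 1) (h0 : g 0 = 1) :
    g 1 = 1 := by
  have hfin : {z : ℂ | z ^ n = 1}.Finite := by
    refine (Polynomial.nthRootsFinset n (1 : ℂ)).finite_toSet.subset fun z hz => ?_
    exact (Polynomial.mem_nthRootsFinset (Nat.pos_of_ne_zero hn) _).2 hz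
  have hsub := hfin.countable.isTotallyDisconnected (g '' Icc 0 1)
    (by rintro _ ⟨x, hx, rfl⟩; exact h x hx) (isPreconnected_Icc.image g hg)
  rw [← h0]
  exact hsub (mem_image_of_mem g (by simp)) (mem_image_of_mem g (by simp))

/-- Independent stationary increments give only the `(N + 1)`-th power of the transform. The right
root is selected by continuity along the segment from `0` to `u`. -/
theorem integral_exp_step (hX : IsSubordinator P X) (hρ : IsSubordinatorMeasure ρ)
    (hL : ∀ u : ℂ, 0 ≤ u.re →
      ∫ ω, Complex.exp (-u * (X 1 ω : ℂ)) ∂P = Complex.exp (laplaceExponent ρ u))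
    (N : ℕ) {u : ℂ} (hu : 0 ≤ u.re) :
    ∫ ω, Complex.exp (-u * (X (1 / (N + 1)) ω : ℂ)) ∂P =
      Complex.exp (laplaceExponent ρ u / (N + 1)) := by
  have := hX.isProbabilityMeasure
  have hN : ((N : ℂ) + 1) ≠ 0 := by exact_mod_cast N.succ_ne_zero
  have hpow : ∀ w : ℂ, 0 ≤ w.re → (∫ ω, Complex.exp (-w * (X (1 / (N + 1)) ω : ℂ)) ∂P) ^ (N + 1) =
      Complex.exp (laplaceExponent ρ w) := fun w hw => by
    have h := integral_exp_sum_increments hX N (fun _ => w)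
    rw [Finset.prod_const, Finset.card_range] at h
    rw [← h, ← hL w hw]
    refine integral_congr_ae ?_
    filter_upwards [hX.zero] with ω h0
    rw [← Finset.mul_sum, ← Complex.ofReal_sum,
      Finset.sum_range_sub (fun j : ℕ => X ((j : ℝ≥0) / (N + 1)) ω)]
    have h1 : ((N + 1 : ℕ) : ℝ≥0) / ((N : ℝ≥0) + 1) = 1 := by
      push_cast
      exact div_self (by positivity)
    simp [h0]
  -- The quotient of the transform by the candidate root, along the segment; it is `1` at `x = 0`.
  set g : ℝ → ℂ := fun x => (∫ ω, Complex.exp (-(x * u) * (X (1 / (N + 1)) ω : ℂ)) ∂P) *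
    Complex.exp (-(laplaceExponent ρ (x * u) / (N + 1))) with hg
  have hre : ∀ x ∈ Icc (0 : ℝ) 1, 0 ≤ ((x : ℂ) * u).re := fun x hx => by
    simpa using mul_nonneg hx.1 hu
  have hline : ContinuousOn (fun x : ℝ => (x : ℂ) * u) (Icc 0 1) := by fun_prop
  have hcont : ContinuousOn g (Icc 0 1) := by
    refine ContinuousOn.mul ?_ ?_
    · exact (continuousOn_integral_exp hX _).comp hline hre
    · exact ((hρ.continuousOn_laplaceExponent.comp hline hre).div_const _).neg.cexp
  have h1 := eq_one_of_continuousOn_pow_eq_one N.succ_ne_zero hcont (fun x hx => ?_) ?_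
  · simp only [hg, Complex.ofReal_one, one_mul] at h1
    rw [Complex.exp_neg] at h1
    exact (mul_inv_eq_one₀ (Complex.exp_ne_zero _)).1 h1
  · simp only [hg]
    rw [mul_pow, hpow _ (hre x hx), ← Complex.exp_nat_mul, ← Complex.exp_add]
    push_cast
    rw [mul_neg, mul_div_cancel₀ _ hN, add_neg_cancel, Complex.exp_zero]
  · simp [hg]

/-- On the cell `(j / (N + 1), (j + 1) / (N + 1)]` the rounded time is the right endpoint;
subtracting `1 / (N + 1)` gives the left one. -/
theorem sum_eq_integral_grid (h : ℝ → ℂ) (N : ℕ) :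
    ∑ j ∈ Finset.range (N + 1), h ((j : ℝ) / (N + 1)) / (N + 1) =
      ∫ s in (0 : ℝ)..1, h ((gridCeil N s : ℝ) - 1 / (N + 1)) := by
  have hN : (0 : ℝ) < (N : ℝ) + 1 := by positivity
  have hconst : ∀ j : ℕ, ∀ s ∈ uIoc ((j : ℝ) / (N + 1)) (((j + 1 : ℕ) : ℝ) / (N + 1)),
      h ((gridCeil N s : ℝ) - 1 / (N + 1)) = h ((j : ℝ) / (N + 1)) := fun j s hs => by
    rw [uIoc_of_le (by gcongr; exact_mod_cast j.le_succ)] at hs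
    have hc : ⌈s * ((N : ℝ) + 1)⌉₊ = j + 1 := by
      rw [Nat.ceil_eq_iff j.succ_ne_zero]
      exact ⟨by simpa using (div_lt_iff₀ hN).1 hs.1, (le_div_iff₀ hN).1 hs.2⟩
    rw [coe_gridCeil, hc]
    congr 1
    push_cast
    ring
  have hint : ∀ j < N + 1, IntervalIntegrable (fun s => h ((gridCeil N s : ℝ) - 1 / (N + 1))) volume
      ((j : ℝ) / (N + 1)) (((j + 1 : ℕ) : ℝ) / (N + 1)) := fun j _ =>
    (intervalIntegrable_const (c := h ((j : ℝ) / (N + 1)))).congr fun s hs => (hconst j s hs).symm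
  have hsum := intervalIntegral.sum_integral_adjacent_intervals hint
  have h1 : (((N + 1 : ℕ) : ℝ)) / ((N : ℝ) + 1) = 1 := by push_cast; exact div_self hN.ne'
  rw [h1, Nat.cast_zero, zero_div] at hsum
  rw [← hsum]
  refine Finset.sum_congr rfl fun j _ => ?_
  rw [intervalIntegral.integral_congr_ae (Eventually.of_forall (hconst j)),
    intervalIntegral.integral_const, ← sub_div]
  push_cast
  rw [add_sub_cancel_left, Complex.real_smul]
  push_cast
  ring

variable {m : Measure ℝ} [IsFiniteMeasure m]

/-- Summation by parts: `f (gridCeil N s)` telescopes into the increments over cells that start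
before `s`, and integrating over `s` weights each by a tail of `m`. -/
theorem integral_gridCeil_eq_sum (hm : ∀ᵐ s ∂m, s ∈ Icc (0 : ℝ) 1) {f : ℝ≥0 → ℝ} (h0 : f 0 = 0)
    (N : ℕ) : ∫ s, f (gridCeil N s) ∂m = ∑ j ∈ Finset.range (N + 1),
      m.real (Ioi ((j : ℝ) / (N + 1))) *
        (f (((j + 1 : ℕ) : ℝ≥0) / (N + 1)) - f ((j : ℝ≥0) / (N + 1))) := by
  have hN : (0 : ℝ) < (N : ℝ) + 1 := by positivity
  have hpt : ∀ s ∈ Icc (0 : ℝ) 1, f (gridCeil N s) = ∑ j ∈ Finset.range (N + 1),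
      (Ioi ((j : ℝ) / (N + 1))).indicator
        (fun _ => f (((j + 1 : ℕ) : ℝ≥0) / (N + 1)) - f ((j : ℝ≥0) / (N + 1))) s := fun s hs => by
    have hle : ⌈s * ((N : ℝ) + 1)⌉₊ ≤ N + 1 := by
      rw [Nat.ceil_le]
      push_cast
      nlinarith [hs.2]
    have hsub := Finset.sum_range_sub (fun j : ℕ => f ((j : ℝ≥0) / (N + 1))) ⌈s * ((N : ℝ) + 1)⌉₊
    simp only [Nat.cast_zero, zero_div, h0, sub_zero] at hsub
    rw [gridCeil, ← hsub]
    have hiff : ∀ j : ℕ, s ∈ Ioi ((j : ℝ) / (N + 1)) ↔ j ∈ Finset.range ⌈s * ((N : ℝ) + 1)⌉₊ :=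
      fun j => by rw [mem_Ioi, div_lt_iff₀ hN, Finset.mem_range, Nat.lt_ceil]
    rw [← Finset.sum_subset (Finset.range_subset_range.2 hle)]
    · exact Finset.sum_congr rfl fun j hj => (indicator_of_mem ((hiff j).2 hj)
        (fun _ => f (((j + 1 : ℕ) : ℝ≥0) / (N + 1)) - f ((j : ℝ≥0) / (N + 1)))).symm
    · exact fun j _ hj => indicator_of_notMem (fun h => hj ((hiff j).1 h)) _
  rw [integral_congr_ae (hm.mono hpt), integral_finsetSum]
  · refine Finset.sum_congr rfl fun j _ => ?_
    rw [integral_indicator measurableSet_Ioi, setIntegral_const, smul_eq_mul]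
  · exact fun j _ => (integrable_const _).indicator measurableSet_Ioi

/-- The grid rounds upwards, so right-continuity is enough, and monotonicity gives the bound `f 1`.
-/
theorem tendsto_integral_gridCeil (hm : ∀ᵐ s ∂m, s ∈ Icc (0 : ℝ) 1) {f : ℝ≥0 → ℝ}
    (hf : Monotone f) (h0 : f 0 = 0) (hc : IsCadlag f) :
    Tendsto (fun N => ∫ s, f (gridCeil N s) ∂m) atTop (𝓝 (∫ s, f s.toNNReal ∂m)) := by
  have hgm := measurable_gridCeil
  refine tendsto_integral_of_dominated_convergence (fun _ => f 1)
    (fun N => (hf.measurable.comp (hgm N)).aestronglyMeasurable) (integrable_const _) (fun N => ?_) ?_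
  · filter_upwards [hm] with s hs
    rw [Real.norm_of_nonneg (h0 ▸ hf zero_le)]
    exact hf (gridCeil_le_one N hs.2)
  · filter_upwards [hm] with s hs
    refine (hc s.toNNReal).1.tendsto.comp ?_
    exact tendsto_nhdsWithin_iff.2 ⟨tendsto_gridCeil hs.1, Eventually.of_forall fun N => le_gridCeil N s⟩

theorem measurable_laplaceExponent (ρ : Measure ℝ) [SFinite ρ] :
    Measurable (laplaceExponent ρ) := by
  have h : StronglyMeasurable (Function.uncurry fun (w : ℂ) (z : ℝ) =>
      Complex.exp (-w * (z : ℂ)) - 1) := by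
    refine Measurable.stronglyMeasurable ?_
    unfold Function.uncurry
    fun_prop
  exact h.integral_prod_right.measurable

/-- On a grid the integral is a sum of independent increments weighted by the tails `m((s, ∞))`, so
the log-transform is a Riemann sum of `ψ(m((s, ∞)) u)` over `[0, 1]`. Both sides converge under
refinement. -/
theorem integral_exp_integral_subordinator (hX : IsSubordinator P X) [SFinite ρ]
    (hρ : IsSubordinatorMeasure ρ)
    (hL : ∀ u : ℂ, 0 ≤ u.re →
      ∫ ω, Complex.exp (-u * (X 1 ω : ℂ)) ∂P = Complex.exp (laplaceExponent ρ u))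
    (hm : ∀ᵐ s ∂m, s ∈ Icc (0 : ℝ) 1) {u : ℂ} (hu : 0 ≤ u.re) :
    ∫ ω, Complex.exp (-u * ((∫ s, X s.toNNReal ω ∂m : ℝ) : ℂ)) ∂P =
      Complex.exp (laplaceExponent
        (scaledMeasure ρ (volume.restrict (Ioc 0 1)) fun s => m.real (Ioi s)) u) := by
  have := hX.isProbabilityMeasure
  set k : ℝ → ℝ := fun s => m.real (Ioi s) with hk
  have hanti : Antitone k := fun s t hst => measureReal_mono (Ioi_subset_Ioi hst)
  have hk0 : ∀ s, 0 ≤ k s := fun s => measureReal_nonneg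
  have hk1 : ∀ s, k s ≤ m.real univ := fun s => measureReal_mono (subset_univ _)
  have hkre : ∀ s, 0 ≤ ((k s : ℂ) * u).re := fun s => by simpa using mul_nonneg (hk0 s) hu
  have hstep : ∀ N : ℕ, ∫ ω, Complex.exp (-u * ((∫ s, X (gridCeil N s) ω ∂m : ℝ) : ℂ)) ∂P =
      Complex.exp (∫ s in (0 : ℝ)..1,
        laplaceExponent ρ ((k ((gridCeil N s : ℝ) - 1 / (N + 1)) : ℂ) * u)) := fun N => by
    rw [← sum_eq_integral_grid (fun s => laplaceExponent ρ ((k s : ℂ) * u)), Complex.exp_sum]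
    rw [← Finset.prod_congr rfl fun (j : ℕ) _ =>
      integral_exp_step hX hρ hL N (hkre ((j : ℝ) / (N + 1))),
      ← integral_exp_sum_increments hX N fun j => (k ((j : ℝ) / (N + 1)) : ℂ) * u]
    refine integral_congr_ae ?_
    filter_upwards [hX.zero] with ω h0
    rw [integral_gridCeil_eq_sum hm (f := fun t => X t ω) h0 N]
    congr 1
    push_cast
    rw [Finset.mul_sum]
    refine Finset.sum_congr rfl fun j _ => ?_
    ring
  have hl : Tendsto (fun N => ∫ ω, Complex.exp (-u * ((∫ s, X (gridCeil N s) ω ∂m : ℝ) : ℂ)) ∂P)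
      atTop (𝓝 (∫ ω, Complex.exp (-u * ((∫ s, X s.toNNReal ω ∂m : ℝ) : ℂ)) ∂P)) := by
    refine tendsto_integral_of_dominated_convergence (fun _ => 1) (fun N => ?_)
      (integrable_const _) (fun N => ?_) ?_
    -- Measurability in `ω` is taken from the finite sum of increments that equals the integral
    -- almost surely.
    · have hae : (fun ω => ∑ j ∈ Finset.range (N + 1), m.real (Ioi ((j : ℝ) / (N + 1))) *
        (X (((j + 1 : ℕ) : ℝ≥0) / (N + 1)) ω - X ((j : ℝ≥0) / (N + 1)) ω)) =ᵐ[P]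
          fun ω => ∫ s, X (gridCeil N s) ω ∂m := by
        filter_upwards [hX.zero] with ω h0
        exact (integral_gridCeil_eq_sum hm (f := fun t => X t ω) h0 N).symm
      have h1 : AEMeasurable (fun ω => ∫ s, X (gridCeil N s) ω ∂m) P := by
        refine AEMeasurable.congr (Measurable.aemeasurable ?_) hae
        refine Finset.measurable_sum _ fun j _ => ?_
        exact ((hX.measurable _).sub (hX.measurable _)).const_mul _
      have h2 : Continuous fun x : ℝ => Complex.exp (-u * (x : ℂ)) := by fun_prop
      exact (h2.measurable.comp_aemeasurable h1).aestronglyMeasurable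
    · filter_upwards [hX.ae_nonneg] with ω h0
      exact norm_exp_neg_mul_le_one hu (integral_nonneg fun s => h0 _)
    · filter_upwards [hX.monotone, hX.zero, hX.cadlag] with ω h1 h2 h3
      have h4 : Continuous fun x : ℝ => Complex.exp (-u * (x : ℂ)) := by fun_prop
      exact (h4.tendsto _).comp (tendsto_integral_gridCeil hm h1 h2 h3)
  have hr : Tendsto (fun N : ℕ => ∫ s in (0 : ℝ)..1,
      laplaceExponent ρ ((k ((gridCeil N s : ℝ) - 1 / (N + 1)) : ℂ) * u)) atTop
      (𝓝 (∫ s in (0 : ℝ)..1, laplaceExponent ρ ((k s : ℂ) * u))) := by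
    refine intervalIntegral.tendsto_integral_filter_of_dominated_convergence
      (fun _ => 2 * (m.real univ * ‖u‖ + 1) * ∫ z, min z 1 ∂ρ) ?_ ?_ intervalIntegrable_const ?_
    · refine Eventually.of_forall fun N => ?_
      have hgm := measurable_gridCeil N
      have hkm := hanti.measurable
      have h1 : Measurable fun s : ℝ => (k ((gridCeil N s : ℝ) - 1 / (N + 1)) : ℂ) * u := by fun_prop
      exact ((measurable_laplaceExponent ρ).comp h1).aestronglyMeasurable
    · refine Eventually.of_forall fun N => Eventually.of_forall fun s _ => ?_
      refine (hρ.norm_laplaceExponent_le (hkre _)).trans ?_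
      have h1 : 0 ≤ ∫ z, min z 1 ∂ρ := integral_nonneg_of_ae (by
        filter_upwards [hρ.ae_nonneg] with z hz using le_min hz zero_le_one)
      rw [norm_mul, Complex.norm_real, Real.norm_of_nonneg (hk0 _)]
      have := hk1 ((gridCeil N s : ℝ) - 1 / (N + 1))
      gcongr
    -- The tail of `m` is monotone, so it is continuous off a countable, hence null, set of `s`.
    · filter_upwards [hanti.countable_not_continuousAt.ae_notMem volume] with s hs hs1
      have hs' : ContinuousAt k s := by simpa using hs
      rw [uIoc_of_le zero_le_one] at hs1
      have h1 : Tendsto (fun N : ℕ => (gridCeil N s : ℝ) - 1 / ((N : ℝ) + 1)) atTop (𝓝 s) := by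
        have h2 := NNReal.tendsto_coe.2 (tendsto_gridCeil hs1.1.le)
        rw [Real.coe_toNNReal _ hs1.1.le] at h2
        simpa using h2.sub tendsto_one_div_add_atTop_nhds_zero_nat
      have h2 := hs'.tendsto.comp h1
      have h3 : Tendsto (fun N : ℕ => (k ((gridCeil N s : ℝ) - 1 / ((N : ℝ) + 1)) : ℂ) * u) atTop
          (𝓝 ((k s : ℂ) * u)) := ((Complex.continuous_ofReal.tendsto _).comp h2).mul_const u
      refine (hρ.continuousOn_laplaceExponent _ (hkre s)).tendsto.comp ?_
      exact tendsto_nhdsWithin_iff.2 ⟨h3, Eventually.of_forall fun N => hkre _⟩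
  have hfin : laplaceExponent (scaledMeasure ρ (volume.restrict (Ioc 0 1)) k) u =
      ∫ s in (0 : ℝ)..1, laplaceExponent ρ ((k s : ℂ) * u) := by
    rw [intervalIntegral.integral_of_le zero_le_one]
    exact laplaceExponent_scaledMeasure hρ hanti.measurable
      (Eventually.of_forall fun s => ⟨hk0 s, hk1 s⟩) hu
  rw [hfin]
  refine tendsto_nhds_unique hl ?_
  simp only [hstep]
  exact (Complex.continuous_exp.tendsto _).comp hr

end

/-! ### Iterated averages and integrals of monotone paths -/

/-- After the substitution `s = t v`, `m'` is the image of `v^j dv ⊗ m` under multiplication. It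
depends neither on `f` nor on `t`, which is what lets the step be iterated. -/
theorem exists_measure_integral_mul (m : Measure ℝ) [IsFiniteMeasure m]
    (hm : ∀ᵐ s ∂m, s ∈ Ioc (0 : ℝ) 1) (hm0 : m ≠ 0) (j : ℕ) :
    ∃ m' : Measure ℝ, IsFiniteMeasure m' ∧ (∀ᵐ s ∂m', s ∈ Ioc (0 : ℝ) 1) ∧ m' ≠ 0 ∧
      ∀ f : ℝ≥0 → ℝ, Monotone f → ∀ t : ℝ, 0 < t →
        ∫ s in (0 : ℝ)..t, s ^ j * ∫ r, f (s * r).toNNReal ∂m =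
          t ^ (j + 1) * ∫ r, f (t * r).toNNReal ∂m' := by
  set κ : Measure ℝ := (volume.restrict (Ioc (0 : ℝ) 1)).withDensity
    fun v => ((v ^ j).toNNReal : ℝ≥0∞) with hκ
  have hκfin : IsFiniteMeasure κ := by
    refine isFiniteMeasure_withDensity (lt_of_le_of_lt (lintegral_mono_ae (g := fun _ => 1) ?_) ?_).ne
    · filter_upwards [ae_restrict_mem measurableSet_Ioc] with v hv
      have : v ^ j ≤ 1 := pow_le_one₀ hv.1.le hv.2
      simpa using this
    · simp
  have hκae : ∀ᵐ v ∂κ, v ∈ Ioc (0 : ℝ) 1 :=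
    (withDensity_absolutelyContinuous _ _).ae_le (ae_restrict_mem measurableSet_Ioc)
  have hκ0 : κ ≠ 0 := fun h => by
    have hac : volume.restrict (Ioc (0 : ℝ) 1) ≪ κ := by
      refine withDensity_absolutelyContinuous' (by fun_prop) ?_
      filter_upwards [ae_restrict_mem measurableSet_Ioc] with v hv
      have : 0 < v ^ j := pow_pos hv.1 j
      simpa using this
    have := hac (s := univ) (by rw [h]; simp)
    simp at this
  have hmul : Measurable fun p : ℝ × ℝ => p.1 * p.2 := by fun_prop
  have hprod : ∀ᵐ p ∂(κ.prod m), p.1 ∈ Ioc (0 : ℝ) 1 ∧ p.2 ∈ Ioc (0 : ℝ) 1 := ae_prod_of_ae hκae hm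
  refine ⟨(κ.prod m).map fun p => p.1 * p.2, inferInstance, ?_, ?_, fun f hf t ht => ?_⟩
  · refine (ae_map_iff hmul.aemeasurable measurableSet_Ioc).2 ?_
    filter_upwards [hprod] with p hp
    exact ⟨mul_pos hp.1.1 hp.2.1, mul_le_one₀ hp.1.2 hp.2.1.le hp.2.2⟩
  · rw [Ne, Measure.map_eq_zero_iff hmul.aemeasurable, ← Measure.measure_univ_eq_zero,
      ← univ_prod_univ, Measure.prod_prod, mul_eq_zero, Measure.measure_univ_eq_zero,
      Measure.measure_univ_eq_zero]
    exact not_or.2 ⟨hκ0, hm0⟩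
  · have hfm : Measurable fun s : ℝ => f (t * s).toNNReal := hf.measurable.comp (by fun_prop)
    have hint : Integrable (fun p : ℝ × ℝ => f (t * (p.1 * p.2)).toNNReal) (κ.prod m) := by
      refine (integrable_const (max |f t.toNNReal| |f 0|)).mono'
        (hfm.comp hmul).aestronglyMeasurable ?_
      filter_upwards [hprod] with p hp
      have h1 : t * (p.1 * p.2) ≤ t :=
        mul_le_of_le_one_right ht.le (mul_le_one₀ hp.1.2 hp.2.1.le hp.2.2)
      have h2 : f (t * (p.1 * p.2)).toNNReal ≤ f t.toNNReal := hf (Real.toNNReal_le_toNNReal h1)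
      have h3 : f 0 ≤ f (t * (p.1 * p.2)).toNNReal := hf zero_le
      rw [Real.norm_eq_abs, max_comm]
      exact abs_le_max_abs_abs h3 h2
    rw [integral_map hmul.aemeasurable hfm.aestronglyMeasurable, integral_prod _ hint, hκ,
      integral_withDensity_eq_integral_smul (by fun_prop)]
    have hsub := intervalIntegral.mul_integral_comp_mul_left (a := 0) (b := 1) (c := t)
      (f := fun s => s ^ j * ∫ r, f (s * r).toNNReal ∂m)
    rw [mul_zero, mul_one] at hsub
    rw [← hsub, intervalIntegral.integral_of_le zero_le_one, pow_succ', mul_assoc]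
    congr 1
    rw [← integral_const_mul]
    refine setIntegral_congr_fun measurableSet_Ioc fun v hv => ?_
    simp only [NNReal.smul_def, smul_eq_mul, Real.coe_toNNReal _ (pow_nonneg hv.1.le j), mul_pow,
      mul_assoc]

theorem exists_measure_iteratedAverage (k : ℕ) :
    ∃ m : Measure ℝ, IsFiniteMeasure m ∧ (∀ᵐ s ∂m, s ∈ Ioc (0 : ℝ) 1) ∧ m ≠ 0 ∧
      ∀ f : ℝ≥0 → ℝ, Monotone f → ∀ t : ℝ≥0, 0 < t →
        iteratedAverage f k t = ∫ r, f (t * r).toNNReal ∂m := by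
  induction k with
  | zero =>
    refine ⟨Measure.dirac 1, inferInstance, ?_, by simp, fun f hf t ht => ?_⟩
    · rw [ae_dirac_eq]; simp
    · simp [iteratedAverage]
  | succ k ih =>
    obtain ⟨m, hfin, hm, hm0, h⟩ := ih
    -- The power is `0`, since the previous average carries no factor of `s`.
    obtain ⟨m', hfin', hm', hm0', h'⟩ := exists_measure_integral_mul m hm hm0 0
    refine ⟨m', hfin', hm', hm0', fun f hf t ht => ?_⟩
    have ht' : (0 : ℝ) < t := ht
    have h1 := h' f hf t ht'
    rw [zero_add, pow_one] at h1
    rw [iteratedAverage, runningAverage, inv_mul_eq_iff_eq_mul₀ ht'.ne', ← h1]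
    refine intervalIntegral.integral_congr_ae (Eventually.of_forall fun s hs => ?_)
    rw [uIoc_of_le ht'.le] at hs
    rw [h f hf _ (Real.toNNReal_pos.2 hs.1), Real.coe_toNNReal _ hs.1.le, pow_zero, one_mul]

theorem exists_measure_iteratedIntegral (k : ℕ) :
    ∃ m : Measure ℝ, IsFiniteMeasure m ∧ (∀ᵐ s ∂m, s ∈ Ioc (0 : ℝ) 1) ∧ m ≠ 0 ∧
      ∀ f : ℝ≥0 → ℝ, Monotone f → ∀ t : ℝ≥0, 0 < t →
        iteratedIntegral f k t = (t : ℝ) ^ k * ∫ r, f (t * r).toNNReal ∂m := by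
  induction k with
  | zero =>
    refine ⟨Measure.dirac 1, inferInstance, ?_, by simp, fun f hf t ht => ?_⟩
    · rw [ae_dirac_eq]; simp
    · simp [iteratedIntegral]
  | succ k ih =>
    obtain ⟨m, hfin, hm, hm0, h⟩ := ih
    -- The power is `k`, the factor `s ^ k` accumulated by the earlier integrations.
    obtain ⟨m', hfin', hm', hm0', h'⟩ := exists_measure_integral_mul m hm hm0 k
    refine ⟨m', hfin', hm', hm0', fun f hf t ht => ?_⟩
    have ht' : (0 : ℝ) < t := ht
    rw [iteratedIntegral, ← h' f hf t ht']
    refine intervalIntegral.integral_congr_ae (Eventually.of_forall fun s hs => ?_)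
    rw [uIoc_of_le ht'.le] at hs
    rw [h f hf _ (Real.toNNReal_pos.2 hs.1), Real.coe_toNNReal _ hs.1.le]

/-! ### Clocks and their Lévy measures -/

section

variable {Ω Ω' : Type u} [MeasurableSpace Ω] [MeasurableSpace Ω'] {P : Measure Ω} {P' : Measure Ω'}
  {X : ℝ≥0 → Ω → ℝ} {V : ℝ≥0 → Ω' → ℝ} {ν : Measure ℝ} {S : Set ℝ}

/-- `V` is a driftless subordinator whose Lévy measure integrates `|z|^p` near `0` precisely for
`p ∈ S`. -/
structure HasBGSet (P : Measure Ω) (X : ℝ≥0 → Ω → ℝ) (S : Set ℝ) : Prop where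
  isSubordinator : IsSubordinator P X
  exists_measure : ∃ ρ : Measure ℝ, SFinite ρ ∧ IsSubordinatorMeasure ρ ∧ bgSet ρ = S ∧
    ∀ u : ℂ, 0 ≤ u.re → ∫ ω, Complex.exp (-u * (X 1 ω : ℂ)) ∂P = Complex.exp (laplaceExponent ρ u)

theorem IsDriftlessSubordinator.isSubordinatorMeasure (hX : IsDriftlessSubordinator P X ν) :
    IsSubordinatorMeasure ν := by
  refine ⟨?_, hX.levy_integrable⟩
  filter_upwards [measure_eq_zero_iff_ae_notMem.1 hX.levy_nonpos] with z hz
  exact (not_le.1 hz).le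

theorem IsDriftlessSubordinator.hasBGSet (hX : IsDriftlessSubordinator P X ν) :
    HasBGSet P X (bgSet ν) :=
  ⟨hX.toIsSubordinator, ν, sFinite_of_lintegral_min hX.levy_nonpos hX.levy_integrable,
    hX.isSubordinatorMeasure, rfl, hX.laplace⟩

theorem IsDriftlessSubordinator.blumenthalGetoor_eq (hX : IsDriftlessSubordinator P X ν) :
    blumenthalGetoor P X = sInf (bgSet ν) :=
  (isLevyMeasureOf_of_laplace hX.isSubordinatorMeasure
    (measure_mono_null (by simp) hX.levy_nonpos) hX.laplace).blumenthalGetoor_eq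

theorem HasBGSet.gaussianMixture (hX : HasBGSet P X S) {W : ℝ≥0 → Ω → ℝ}
    (hW : IsIndepBrownian P X W) (μ θ : ℝ) :
    (∃ η, IsLevyMeasureOf P (gaussianMixture μ θ X W) η) ∧
      blumenthalGetoor P (gaussianMixture μ θ X W) = 2 * sInf S := by
  obtain ⟨hsub, ρ, hs, hρ, rfl, hL⟩ := hX
  have := hsub.isProbabilityMeasure
  exact blumenthalGetoor_gaussianMixture hW (hsub.measurable 1) (hsub.ae_nonneg.mono fun ω h => h 1)
    hρ hL μ θ

/-- As `m` is nonzero and carried by `(0, 1]`, it charges some `(1 / (n + 1), ∞)`, and its tail is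
then positive on all of `(0, 1 / (n + 1)]`. This is the nondegeneracy required by
`bgSet_scaledMeasure`. -/
theorem volume_pos_tail_ne_zero {m : Measure ℝ} [IsFiniteMeasure m]
    (hm : ∀ᵐ s ∂m, s ∈ Ioc (0 : ℝ) 1) (hm0 : m ≠ 0) :
    (volume.restrict (Ioc (0 : ℝ) 1)) {s | 0 < m.real (Ioi s)} ≠ 0 := by
  obtain ⟨n, hn⟩ : ∃ n : ℕ, m (Ioi (1 / ((n : ℝ) + 1))) ≠ 0 := by
    by_contra! hcon
    refine hm0 (ae_eq_bot.1 (eventually_false_iff_eq_bot.1 ?_))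
    filter_upwards [hm, measure_eq_zero_iff_ae_notMem.1 (measure_iUnion_null hcon)] with s hs hs'
    obtain ⟨n, hn⟩ := exists_nat_one_div_lt hs.1
    exact hs' (mem_iUnion.2 ⟨n, hn⟩)
  have hpos : (0 : ℝ) < 1 / ((n : ℝ) + 1) := by positivity
  have hle : 1 / ((n : ℝ) + 1) ≤ 1 := by
    rw [div_le_one (by positivity)]
    linarith [(Nat.cast_nonneg n : (0 : ℝ) ≤ n)]
  intro h
  have hsub : Ioc (0 : ℝ) (1 / ((n : ℝ) + 1)) ⊆ {s | 0 < m.real (Ioi s)} := fun s hs => by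
    have h1 : m.real (Ioi (1 / ((n : ℝ) + 1))) ≤ m.real (Ioi s) :=
      measureReal_mono (Ioi_subset_Ioi hs.2)
    have h2 : 0 < m.real (Ioi (1 / ((n : ℝ) + 1))) := ENNReal.toReal_pos hn (measure_ne_top _ _)
    exact h2.trans_le h1
  have h3 := measure_mono_null hsub h
  rw [Measure.restrict_apply measurableSet_Ioc, inter_eq_self_of_subset_left
    (Ioc_subset_Ioc_right hle), Real.volume_Ioc, sub_zero, ENNReal.ofReal_eq_zero] at h3
  linarith

theorem HasBGSet.of_isInducedBy (hX : HasBGSet P X S) {A : ℝ≥0 → Ω → ℝ}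
    (hV : IsInducedBy P A P' V) (m : Measure ℝ) [IsFiniteMeasure m]
    (hm : ∀ᵐ s ∂m, s ∈ Ioc (0 : ℝ) 1) (hm0 : m ≠ 0)
    (hA : ∀ ω, Monotone (fun t => X t ω) → A 1 ω = ∫ s, X s.toNNReal ω ∂m) : HasBGSet P' V S := by
  obtain ⟨hsub, ρ, hs, hρ, rfl, hL⟩ := hX
  have hanti : Antitone fun s => m.real (Ioi s) :=
    fun s t hst => measureReal_mono (Ioi_subset_Ioi hst)
  have hb : ∀ᵐ s ∂(volume.restrict (Ioc (0 : ℝ) 1)), 0 ≤ m.real (Ioi s) ∧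
      m.real (Ioi s) ≤ m.real univ :=
    Eventually.of_forall fun s => ⟨measureReal_nonneg, measureReal_mono (subset_univ _)⟩
  refine ⟨hV.1, _, inferInstance, hρ.scaled hanti.measurable hb,
    bgSet_scaledMeasure hρ hanti.measurable hb (volume_pos_tail_ne_zero hm hm0), fun u hu => ?_⟩
  rw [← integral_exp_integral_subordinator hsub hρ hL (hm.mono fun s h => Ioc_subset_Icc_self h) hu]
  have h1 := ((hV.2 1).comp (u := fun x : ℝ => Complex.exp (-u * (x : ℂ))) (by fun_prop)).integral_eq
  refine h1.trans (integral_congr_ae ?_)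
  filter_upwards [hsub.monotone] with ω hω
  simp only [Function.comp_apply]
  rw [hA ω hω]

theorem HasBGSet.of_hasLaplaceTransform (hX : IsDriftlessSubordinator P X ν) {ψ : ℂ → ℂ}
    (hV : HasLaplaceTransform P' V ψ) (κ : Measure ℝ) [IsFiniteMeasure κ] {k : ℝ → ℝ} {C : ℝ}
    (hk : Measurable k) (hkC : ∀ᵐ s ∂κ, 0 ≤ k s ∧ k s ≤ C) (hpos : κ {s | 0 < k s} ≠ 0)
    (hψ : ∀ u, ψ u = ∫ s, laplaceExponent ν ((k s : ℂ) * u) ∂κ) : HasBGSet P' V (bgSet ν) := by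
  have := sFinite_of_lintegral_min hX.levy_nonpos hX.levy_integrable
  have hν := hX.isSubordinatorMeasure
  refine ⟨hV.1, _, inferInstance, hν.scaled hk hkC, bgSet_scaledMeasure hν hk hkC hpos,
    fun u hu => ?_⟩
  rw [laplaceExponent_scaledMeasure hν hk hkC hu, ← hψ, hV.2 1 u hu]
  simp

/-- Each averaging changes the Lévy measure but not its set of exponents, so `HasBGSet` with fixed
`S` is the invariant of the induction. -/
theorem HasBGSet.of_isTypeIIRecipe (hX : HasBGSet P X S) {k : ℕ}
    (hV : IsTypeIIRecipe P X k Ω' P' V) : HasBGSet P' V S := by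
  induction hV with
  | zero => exact hX
  | succ k Ω₁ Ω₂ P₁ P₂ Y V _ hV ih =>
    obtain ⟨m, hfin, hm, hm0, h⟩ := exists_measure_iteratedAverage 1
    refine ih.of_isInducedBy hV m hm hm0 fun ω hω => ?_
    simpa [iteratedAverage] using h _ hω 1 one_pos

/-! ### Kernels of non-integer degree -/

/-- The substitution `v = exp (-x)` turns this into the convergence of the Gamma integral. -/
theorem integrableOn_neg_log_rpow {n : ℝ} (hn : 0 < n) :
    IntegrableOn (fun v : ℝ => (-Real.log v) ^ (n - 1)) (Ioo 0 1) := by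
  have himg : Ioo (0 : ℝ) 1 ⊆ (fun x => Real.exp (-x)) '' Ioi 0 := fun v hv =>
    ⟨-Real.log v, by simpa using Real.log_neg hv.1 hv.2, by simp [Real.exp_log hv.1]⟩
  refine IntegrableOn.mono_set ?_ himg
  have hderiv : ∀ x ∈ Ioi (0 : ℝ),
      HasDerivWithinAt (fun x => Real.exp (-x)) (-Real.exp (-x)) (Ioi 0) x := fun x _ => by
    simpa using ((hasDerivAt_neg x).exp).hasDerivWithinAt
  have hinj : InjOn (fun x : ℝ => Real.exp (-x)) (Ioi 0) := fun x _ y _ hxy => by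
    simpa using hxy
  rw [integrableOn_image_iff_integrableOn_abs_deriv_smul measurableSet_Ioi hderiv hinj]
  refine (Real.GammaIntegral_convergent hn).congr_fun (fun x _ => ?_) measurableSet_Ioi
  simp

theorem integrableOn_upperIncompleteGamma {n : ℝ} (hn : 0 < n) :
    IntegrableOn (fun x : ℝ => x ^ (n - 1) * Real.exp (-x)) (Ioi 0) := by
  simpa only [mul_comm] using Real.GammaIntegral_convergent hn

theorem upperIncompleteGamma_zero {n : ℝ} (hn : 0 < n) :
    upperIncompleteGamma n 0 = Real.Gamma n := by
  rw [Real.Gamma_eq_integral hn, upperIncompleteGamma]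
  simp only [mul_comm]

theorem upperIncompleteGamma_nonneg (n : ℝ) {a : ℝ} (ha : 0 ≤ a) :
    0 ≤ upperIncompleteGamma n a :=
  setIntegral_nonneg measurableSet_Ioi fun _ hx =>
    mul_nonneg (Real.rpow_nonneg (ha.trans (le_of_lt hx)) _) (Real.exp_pos _).le

/-- The missing piece is the integral of a positive function over `(0, a]`. Strictness makes the
type I kernel positive on `(0, 1)`. -/
theorem upperIncompleteGamma_lt {n a : ℝ} (hn : 0 < n) (ha : 0 < a) :
    upperIncompleteGamma n a < Real.Gamma n := by
  have hint := integrableOn_upperIncompleteGamma hn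
  have hsplit : upperIncompleteGamma n 0 =
      (∫ x in Ioc 0 a, x ^ (n - 1) * Real.exp (-x)) + upperIncompleteGamma n a := by
    rw [upperIncompleteGamma, upperIncompleteGamma, ← setIntegral_union
      (Ioc_disjoint_Ioi le_rfl) measurableSet_Ioi (hint.mono_set Ioc_subset_Ioi_self)
      (hint.mono_set (Ioi_subset_Ioi ha.le)), Ioc_union_Ioi_eq_Ioi ha.le]
  have hpos : 0 < ∫ x in (0 : ℝ)..a, x ^ (n - 1) * Real.exp (-x) := by
    refine intervalIntegral.intervalIntegral_pos_of_pos_on ?_ (fun x hx => ?_) ha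
    · rw [intervalIntegrable_iff_integrableOn_Ioc_of_le ha.le]
      exact hint.mono_set Ioc_subset_Ioi_self
    · exact mul_pos (Real.rpow_pos_of_pos hx.1 _) (Real.exp_pos _)
  rw [intervalIntegral.integral_of_le ha.le] at hpos
  rw [← upperIncompleteGamma_zero hn, hsplit]
  linarith

theorem measurable_upperIncompleteGamma (n : ℝ) : Measurable (upperIncompleteGamma n) := by
  have hset : MeasurableSet {p : ℝ × ℝ | p.1 < p.2} := measurableSet_lt measurable_fst measurable_snd
  have hm : StronglyMeasurable ({p : ℝ × ℝ | p.1 < p.2}.indicator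
      fun p => p.2 ^ (n - 1) * Real.exp (-p.2)) :=
    (Measurable.indicator (by fun_prop) hset).stronglyMeasurable
  have h := (StronglyMeasurable.integral_prod_right (ν := (volume : Measure ℝ))
    (f := fun a x => {p : ℝ × ℝ | p.1 < p.2}.indicator
      (fun p => p.2 ^ (n - 1) * Real.exp (-p.2)) (a, x)) hm).measurable
  convert h using 2
  rw [upperIncompleteGamma, ← integral_indicator measurableSet_Ioi]
  rfl

/-! ### Exponents of the three types of clocks -/

theorem HasBGSet.of_isTypeIClock (hX : IsDriftlessSubordinator P X ν) {n : ℝ}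
    (hV : IsTypeIClock P X ν n P' V) : HasBGSet P' V (bgSet ν) := by
  rcases hV with ⟨k, -, -, hV⟩ | ⟨hn, -, hV⟩
  · obtain ⟨m, hfin, hm, hm0, h⟩ := exists_measure_iteratedAverage k
    refine hX.hasBGSet.of_isInducedBy hV m hm hm0 fun ω hω => ?_
    simpa using h _ hω 1 one_pos
  · have hm : Measurable fun s => 1 - upperIncompleteGamma n (-Real.log s) / Real.Gamma n :=
      (((measurable_upperIncompleteGamma n).comp (by fun_prop :
        Measurable fun s : ℝ => -Real.log s)).div_const _).const_sub 1
    have hΓ := Real.Gamma_pos_of_pos hn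
    have hbd : ∀ s ∈ Ioo (0 : ℝ) 1,
        0 < 1 - upperIncompleteGamma n (-Real.log s) / Real.Gamma n ∧
          1 - upperIncompleteGamma n (-Real.log s) / Real.Gamma n ≤ 1 := fun s hs => by
      have hlog : 0 < -Real.log s := neg_pos.2 (Real.log_neg hs.1 hs.2)
      have h1 := upperIncompleteGamma_lt hn hlog
      have h2 := upperIncompleteGamma_nonneg n hlog.le
      exact ⟨sub_pos.2 ((div_lt_one hΓ).2 h1), sub_le_self _ (div_nonneg h2 hΓ.le)⟩
    -- The open interval avoids both endpoints, where `Real.log` is `0` (at `s = 0` by convention)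
    -- and the kernel vanishes.
    refine HasBGSet.of_hasLaplaceTransform hX hV (volume.restrict (Ioo (0 : ℝ) 1)) hm
      (C := 1) ?_ ?_ fun u => ?_
    · filter_upwards [ae_restrict_mem measurableSet_Ioo] with s hs
      exact ⟨(hbd s hs).1.le, (hbd s hs).2⟩
    · intro h0
      have h1 := measure_mono_null (fun s hs => (hbd s hs).1) h0
      simp at h1
    · rw [intervalIntegral.integral_of_le zero_le_one, integral_Ioc_eq_integral_Ioo]

theorem HasBGSet.of_isTypeIIClock (hX : IsDriftlessSubordinator P X ν) {n : ℝ}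
    (hV : IsTypeIIClock P X ν n P' V) : HasBGSet P' V (bgSet ν) := by
  rcases hV with ⟨k, -, -, hV⟩ | ⟨hn, -, hV⟩
  · exact hX.hasBGSet.of_isTypeIIRecipe hV
  · have hΓ := Real.Gamma_pos_of_pos hn
    -- The logarithmic weight, unbounded for some `n`, goes into the finite measure `κ`; the scaling
    -- kernel is then the identity, bounded by `1`.
    set d : ℝ → ℝ≥0 := fun v => ((Real.Gamma n)⁻¹ * (-Real.log v) ^ (n - 1)).toNNReal with hd
    have hdm : Measurable d := by fun_prop
    set κ : Measure ℝ := (volume.restrict (Ioo (0 : ℝ) 1)).withDensity fun v => (d v : ℝ≥0∞) with hκ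
    have hfin : IsFiniteMeasure κ := by
      have h1 := ((integrableOn_neg_log_rpow hn).const_mul (Real.Gamma n)⁻¹).lintegral_lt_top
      exact isFiniteMeasure_withDensity h1.ne
    have hlog : ∀ v ∈ Ioo (0 : ℝ) 1, 0 < (Real.Gamma n)⁻¹ * (-Real.log v) ^ (n - 1) :=
      fun v hv => mul_pos (inv_pos.2 hΓ)
        (Real.rpow_pos_of_pos (neg_pos.2 (Real.log_neg hv.1 hv.2)) _)
    have hae : ∀ᵐ v ∂κ, v ∈ Ioo (0 : ℝ) 1 :=
      (withDensity_absolutelyContinuous _ _).ae_le (ae_restrict_mem measurableSet_Ioo)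
    refine HasBGSet.of_hasLaplaceTransform hX hV κ measurable_id (C := 1) ?_ ?_ fun u => ?_
    · filter_upwards [hae] with v hv using ⟨hv.1.le, hv.2.le⟩
    · intro h0
      have hac : volume.restrict (Ioo (0 : ℝ) 1) ≪ κ := by
        refine withDensity_absolutelyContinuous' (by fun_prop) ?_
        filter_upwards [ae_restrict_mem measurableSet_Ioo] with v hv
        simpa [hd] using hlog v hv
      have h1 := measure_mono_null (fun s (hs : s ∈ Ioo (0 : ℝ) 1) => hs.1) (hac h0)
      simp at h1
    · rw [intervalIntegral.integral_of_le zero_le_one, integral_Ioc_eq_integral_Ioo, hκ,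
        integral_withDensity_eq_integral_smul hdm, ← integral_const_mul]
      refine setIntegral_congr_fun measurableSet_Ioo fun v hv => ?_
      simp only [hd, NNReal.smul_def, Real.coe_toNNReal _ (hlog v hv).le, Complex.real_smul, id,
        mul_comm u]
      push_cast
      ring

theorem HasBGSet.of_isTypeIIIClock (hX : IsDriftlessSubordinator P X ν) {n : ℝ}
    (hV : IsTypeIIIClock P X ν n P' V) : HasBGSet P' V (bgSet ν) := by
  rcases hV with ⟨k, -, -, hV⟩ | ⟨hn, -, hV⟩
  · obtain ⟨m, hfin, hm, hm0, h⟩ := exists_measure_iteratedIntegral k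
    refine hX.hasBGSet.of_isInducedBy hV m hm hm0 fun ω hω => ?_
    simpa using h _ hω 1 one_pos
  · have hΓ := Real.Gamma_pos_of_pos (by linarith : 0 < n + 1)
    refine HasBGSet.of_hasLaplaceTransform hX hV (volume.restrict (Ioc (0 : ℝ) 1))
      (k := fun s => s ^ n / Real.Gamma (n + 1)) (by fun_prop)
      (C := 1 / Real.Gamma (n + 1)) ?_ ?_ fun u => ?_
    · filter_upwards [ae_restrict_mem measurableSet_Ioc] with s hs
      have h1 : s ^ n ≤ 1 := Real.rpow_le_one hs.1.le hs.2 hn.le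
      have h2 : 0 ≤ s ^ n := Real.rpow_nonneg hs.1.le n
      exact ⟨by positivity, by gcongr⟩
    · intro h0
      have h1 := measure_mono_null (fun s (hs : s ∈ Ioc (0 : ℝ) 1) =>
        div_pos (Real.rpow_pos_of_pos hs.1 n) hΓ) h0
      simp at h1
    · rw [intervalIntegral.integral_of_le zero_le_one]

end

theorem corollary6 {Ω : Type u} [MeasurableSpace Ω] (P : Measure Ω)
    (X : ℝ≥0 → Ω → ℝ) (ν : Measure ℝ) (hX : IsDriftlessSubordinator P X ν) (μ θ : ℝ) :
    (∀ W : ℝ≥0 → Ω → ℝ, IsIndepBrownian P X W →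
      (∃ η, IsLevyMeasureOf P (gaussianMixture μ θ X W) η) ∧
      blumenthalGetoor P (gaussianMixture μ θ X W) = 2 * blumenthalGetoor P X) ∧
    (∀ n : ℝ, 0 < n → ∀ (Ω' : Type u) [MeasurableSpace Ω'] (P' : Measure Ω')
      (V W : ℝ≥0 → Ω' → ℝ), IsIndepBrownian P' V W →
      (IsTypeIClock P X ν n P' V ∨ IsTypeIIClock P X ν n P' V ∨ IsTypeIIIClock P X ν n P' V) →
      (∃ η, IsLevyMeasureOf P' (gaussianMixture μ θ V W) η) ∧
      blumenthalGetoor P' (gaussianMixture μ θ V W) = 2 * blumenthalGetoor P X) := by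
  refine ⟨fun W hW => ?_, fun n _ Ω' _ P' V W hW hV => ?_⟩
  · rw [hX.blumenthalGetoor_eq]
    exact hX.hasBGSet.gaussianMixture hW μ θ
  · rw [hX.blumenthalGetoor_eq]
    have h : HasBGSet P' V (bgSet ν) := by
      rcases hV with hV | hV | hV
      · exact HasBGSet.of_isTypeIClock hX hV
      · exact HasBGSet.of_isTypeIIClock hX hV
      · exact HasBGSet.of_isTypeIIIClock hX hV
    exact h.gaussianMixture hW μ θ
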